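/- Let $q$ be an indeterminate. Write $(a;q)_k=\prod_{i=0}^{k-1}(1-aq^i)$ for the $q$-shifted factorial, ${M\brack N}_q=\frac{(q;q)_M}{(q;q)_N(q;q)_{M-N}}$ for $0\le N\le M$ (and $0$ otherwise) for the $q$-binomial coefficient, $\Phi_m(q)$ for the $m$-th cyclotomic polynomial, and $\left(\frac{\cdot}{n}\right)$ for the Kronecker symbol (which is the Jacobi symbol for odd $n$). For rational functions $A(q),B(q)$ and a polynomial $P(q)\in\mathbb{Z}[q]$, write $A(q)\equiv B(q)\pmod{P(q)}$ if the numerator of $A(q)-B(q)$, written as a reduced fraction over $\mathbb{Z}[q]$, is divisible by $P(q)$ in $\mathbb{Z}[q]$. Let $n>1$ be an odd integer, let $r\ge 1$ be an integer, and let $d\in\{1,2\}$. Then, modulo $\Phi_{n^r}(q)^{2-d}\prod_{j=1}^r\Phi_{n^j}(q)$, $$\sum_{k=0}^{(n^r-1)/d}\frac{q^k}{(-q;q)_k}{2k\brack k}_q\equiv(-1)^{(n-1)/2}q^{(n-1)(1+n^{2r-1})/4}\sum_{k=0}^{(n^{r-1}-1)/d}\frac{q^{nk}}{(-q^n;q^n)_k}{2k\brack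 k}_{q^n},$$ $$\sum_{k=0}^{(n^r-1)/d}q^k{2k\brack k}_q\equiv q^{(n-1)(1+n^{2r-1})/3}\left(\frac{-3}{n}\right)\sum_{k=0}^{(n^{r-1}-1)/d}q^{nk}{2k\brack k}_{q^n},$$ where the right-hand side of the second congruence is understood to be $0$ if $3\mid n$ (the Kronecker symbol then vanishes). Moreover, for $d=1$ the second congruence also holds for every even integer $n\ge 2$ and every integer $r\ge 1$. -/

import Mathlib

open Polynomial

/-- The `q`-shifted factorial `(a;q)_n = (1 - a)(1 - aq)⋯(1 - aq^(n-1))`. -/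
def qShiftedFactorial {R : Type*} [CommRing R] (a q : R) (n : ℕ) : R :=
  ∏ i ∈ Finset.range n, (1 - a * q ^ i)

/-- The `q`-binomial coefficient `[M, N]_q`. It is used only where `q` is a positive power of the
indeterminate, so that the denominator does not vanish. -/
noncomputable def qBinomialCoeff {K : Type*} [Field K] (q : K) (M N : ℕ) : K :=
  if N ≤ M then
    qShiftedFactorial q q M / (qShiftedFactorial q q N * qShiftedFactorial q q (M - N))
  else 0

/-- Congruence of rational functions modulo a polynomial `P`: the numerator of `A - B`, written as
a reduced fraction over `ℤ[q]`, is divisible by `P` in `ℤ[q]`. -/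
def RatFuncCongr (P : ℤ[X]) (A B : RatFunc ℤ) : Prop :=
  P ∣ IsFractionRing.num ℤ[X] (A - B)

/-- The Kronecker symbol `(a/n)` for `n : ℕ`. Here `ZMod.χ₈ a = (a/2)`, and the odd part
of `n` is treated by the Jacobi symbol. -/
def kroneckerSymbol (a : ℤ) (n : ℕ) : ℤ :=
  if n = 0 then (if a.natAbs = 1 then 1 else 0)
  else ZMod.χ₈ (a : ZMod 8) ^ padicValNat 2 n * jacobiSym a (n / 2 ^ padicValNat 2 n)

/-- The sum `∑_{k=0}^{N} x^k [2k, k]_x / (-x;x)_k`. -/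
noncomputable def weightedCentralSum (x : RatFunc ℤ) (N : ℕ) : RatFunc ℤ :=
  ∑ k ∈ Finset.range (N + 1),
    x ^ k / qShiftedFactorial (-x) x k * qBinomialCoeff x (2 * k) k

/-- The sum `∑_{k=0}^{N} x^k [2k, k]_x`. -/
noncomputable def centralSum (x : RatFunc ℤ) (N : ℕ) : RatFunc ℤ :=
  ∑ k ∈ Finset.range (N + 1), x ^ k * qBinomialCoeff x (2 * k) k

/-- The modulus `Φ_{n^r}(q)^(2-d) ∏_{j=1}^{r} Φ_{n^j}(q)`, for `d = 1, 2`. -/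
noncomputable def dworkModulus (n r d : ℕ) : ℤ[X] :=
  cyclotomic (n ^ r) ℤ ^ (2 - d) * ∏ j ∈ Finset.Icc 1 r, cyclotomic (n ^ j) ℤ

/-! Both congruences are checked by evaluation at primitive roots of unity. A factor `Φ_N` divides
the reduced numerator of a difference as soon as both sides take the same value at one primitive
`N`-th root `ζ`. The factor `Φ_N²`, needed only for `N = n^r` and `d = 1`, is detected at a dual
number `ζ + zε` with `z ≠ 0`, where a polynomial vanishes only if it has a double zero at `ζ`.

At `ζ` of order `N = n^j`, the `q`-Lucas theorem (`gaussBinom_lucas`) makes the summand factor along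
`k = aN + b`. The left side becomes a sum over `a` times one period `∑_{k<N}`. On the right `ζ^n`
has order `n^(j-1)`, the number of blocks is the same, and the sum over `a` is the same, so only the
one-period sums matter. They have closed forms, valid even at dual numbers, that is, modulo `Φ_N²`:
the weighted sum is `(-1)^((N-1)/2) q^((N²-1)/4)` (`sum_weightedCentral_dualNumber`) and the plain
one is `(N/3) q^((N²-1)/3)` (`sum_central_dualNumber`). The sign factors are multiplicative, and the
exponents obey `(n-1)(1+n^(2s+1)) + n(n^(2s)-1) = n^(2s+2)-1` (`dwork_exponent_eq`).

The weighted closed form comes from a polynomial that interpolates `u^l ↦ y^l`, with `u = 1/q`,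
whose derivative at the point in question follows from a palindromic symmetry. The plain one comes
from a finite identity that expands the sum in coefficients `[2n, n+j]` with `3 ∤ j`; for `0 < j <
n` these are multiples of `1 - q^n`, and their linear parts add up to alternating `q`-harmonic sums.
-/

/-- The Gaussian binomial coefficient over a commutative ring, by the `q`-Pascal rule. -/
def gaussBinom {R : Type*} [CommRing R] (q : R) : ℕ → ℕ → R
  | _, 0 => 1
  | 0, _ + 1 => 0
  | M + 1, k + 1 => gaussBinom q M k + q ^ (k + 1) * gaussBinom q M (k + 1)

/-! ### Gaussian binomials and a finite identity for the central sum -/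

section GaussBinom

variable {R : Type*} [CommRing R] (q : R)

@[simp] theorem gaussBinom_zero_right (M : ℕ) : gaussBinom q M 0 = 1 := by
  cases M <;> rfl

@[simp] theorem gaussBinom_zero_succ (k : ℕ) : gaussBinom q 0 (k + 1) = 0 := rfl

theorem gaussBinom_succ_succ (M k : ℕ) :
    gaussBinom q (M + 1) (k + 1) = gaussBinom q M k + q ^ (k + 1) * gaussBinom q M (k + 1) := rfl

theorem gaussBinom_eq_zero_of_lt {M k : ℕ} (h : M < k) : gaussBinom q M k = 0 := by
  induction M generalizing k with
  | zero => obtain ⟨k, rfl⟩ := Nat.exists_eq_succ_of_ne_zero h.ne'; rfl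
  | succ M ih =>
    obtain ⟨k, rfl⟩ := Nat.exists_eq_succ_of_ne_zero (Nat.ne_of_gt (Nat.zero_lt_of_lt h))
    rw [Nat.succ_eq_add_one, gaussBinom_succ_succ, ih (by omega), ih (by omega), mul_zero, add_zero]

@[simp] theorem gaussBinom_self (M : ℕ) : gaussBinom q M M = 1 := by
  induction M with
  | zero => rfl
  | succ M ih =>
    rw [gaussBinom_succ_succ, ih, gaussBinom_eq_zero_of_lt q (Nat.lt_succ_self M), mul_zero,
      add_zero]

theorem gaussBinom_mul_one_sub_right (M k : ℕ) :
    (1 - q ^ (k + 1)) * gaussBinom q M (k + 1) = (1 - q ^ (M - k)) * gaussBinom q M k := by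
  induction M generalizing k with
  | zero => simp
  | succ M ih =>
    rcases lt_or_ge M k with h | h
    · rw [gaussBinom_eq_zero_of_lt q (show M + 1 < k + 1 by omega),
        show M + 1 - k = 0 by omega]
      simp
    cases k with
    | zero =>
      have := ih 0
      simp only [gaussBinom_succ_succ, gaussBinom_zero_right, zero_add, Nat.sub_zero, mul_one] at *
      linear_combination q ^ 1 * this
    | succ k =>
      obtain ⟨b, rfl⟩ : ∃ b, M = k + 1 + b := ⟨M - (k + 1), by omega⟩
      have h1 := ih k
      have h2 := ih (k + 1)
      rw [gaussBinom_succ_succ q _ (k + 1), gaussBinom_succ_succ q _ k]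
      rw [show k + 1 + b - k = b + 1 by omega] at h1
      rw [show k + 1 + b - (k + 1) = b by omega] at h2
      rw [show k + 1 + b + 1 - (k + 1) = b + 1 by omega]
      linear_combination q ^ (k + 2) * h2 + h1

theorem gaussBinom_succ_succ' (M k : ℕ) :
    gaussBinom q (M + 1) (k + 1) = q ^ (M - k) * gaussBinom q M k + gaussBinom q M (k + 1) := by
  rw [gaussBinom_succ_succ]
  linear_combination -gaussBinom_mul_one_sub_right q M k

theorem gaussBinom_succ_mul_one_sub (M k : ℕ) :
    (1 - q ^ (M + 1 - k)) * gaussBinom q (M + 1) k = (1 - q ^ (M + 1)) * gaussBinom q M k := by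
  cases k with
  | zero => simp
  | succ k =>
    rcases lt_or_ge M k with h | h
    · rw [gaussBinom_eq_zero_of_lt q (show M + 1 < k + 1 by omega),
        gaussBinom_eq_zero_of_lt q (show M < k + 1 by omega)]
      simp
    obtain ⟨b, rfl⟩ : ∃ b, M = k + b := ⟨M - k, by omega⟩
    have h1 := gaussBinom_mul_one_sub_right q (k + b) k
    rw [show k + b - k = b by omega] at h1
    rw [gaussBinom_succ_succ, show k + b + 1 - (k + 1) = b by omega]
    linear_combination -h1

theorem gaussBinom_succ_succ_mul_one_sub (M k : ℕ) :
    (1 - q ^ (k + 1)) * gaussBinom q (M + 1) (k + 1) = (1 - q ^ (M + 1)) * gaussBinom q M k := by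
  rcases lt_or_ge M k with h | h
  · rw [gaussBinom_eq_zero_of_lt q (show M + 1 < k + 1 by omega),
      gaussBinom_eq_zero_of_lt q (show M < k by omega)]
    simp
  obtain ⟨b, rfl⟩ : ∃ b, M = k + b := ⟨M - k, by omega⟩
  have h1 := gaussBinom_mul_one_sub_right q (k + b) k
  rw [show k + b - k = b by omega] at h1
  rw [gaussBinom_succ_succ', show k + b - k = b by omega]
  linear_combination h1

theorem map_gaussBinom {S : Type*} [CommRing S] (f : R →+* S) (M k : ℕ) :
    f (gaussBinom q M k) = gaussBinom (f q) M k := by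
  induction M generalizing k with
  | zero => cases k <;> simp
  | succ M ih => cases k <;> simp [gaussBinom_succ_succ, ih]

theorem qShiftedFactorial_succ (a : R) (n : ℕ) :
    qShiftedFactorial a q (n + 1) = qShiftedFactorial a q n * (1 - a * q ^ n) :=
  Finset.prod_range_succ _ _

@[simp] theorem qShiftedFactorial_zero (a : R) : qShiftedFactorial a q 0 = 1 := rfl

theorem map_qShiftedFactorial {S : Type*} [CommRing S] (f : R →+* S) (a : R) (n : ℕ) :
    f (qShiftedFactorial a q n) = qShiftedFactorial (f a) (f q) n := by
  simp [qShiftedFactorial]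

theorem gaussBinom_mul_qShiftedFactorial (a b : ℕ) :
    gaussBinom q (a + b) a * (qShiftedFactorial q q a * qShiftedFactorial q q b) =
      qShiftedFactorial q q (a + b) := by
  induction a with
  | zero => simp
  | succ a ih =>
    have h := gaussBinom_succ_succ_mul_one_sub q (a + b) a
    rw [show a + 1 + b = a + b + 1 by omega, qShiftedFactorial_succ, qShiftedFactorial_succ, ← ih]
    linear_combination (qShiftedFactorial q q a * qShiftedFactorial q q b) * h

theorem qShiftedFactorial_two_mul (k : ℕ) :
    qShiftedFactorial q q (2 * k) =
      qShiftedFactorial q (q ^ 2) k * (qShiftedFactorial q q k * qShiftedFactorial (-q) q k) := by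
  induction k with
  | zero => simp
  | succ k ih =>
    rw [show 2 * (k + 1) = 2 * k + 1 + 1 by ring]
    simp only [qShiftedFactorial_succ, ih]
    ring

/-- Three applications of the two Pascal rules. The truncated exponent `n - j` is harmless: for `n <
j` the coefficient beside it is zero. -/
theorem gaussBinom_two_step (n j : ℕ) :
    gaussBinom q (2 * n + 2) (n + 1 + (j + 1)) =
      (1 + q ^ (2 * n + 1)) * gaussBinom q (2 * n) (n + (j + 1)) +
      q ^ (n + 2 + j) * gaussBinom q (2 * n) (n + (j + 2)) +
      q ^ (n - j) * gaussBinom q (2 * n) (n + j) := by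
  rcases lt_or_ge n (j + 1) with h | h
  · rw [gaussBinom_eq_zero_of_lt q (show 2 * n < n + (j + 1) by omega),
      gaussBinom_eq_zero_of_lt q (show 2 * n < n + (j + 2) by omega)]
    rcases lt_or_ge n j with h' | h'
    · rw [gaussBinom_eq_zero_of_lt q (show 2 * n < n + j by omega),
        gaussBinom_eq_zero_of_lt q (show 2 * n + 2 < n + 1 + (j + 1) by omega)]
      simp
    · obtain rfl : n = j := by omega
      rw [show n + 1 + (n + 1) = 2 * n + 2 by ring, show n + n = 2 * n by ring]
      simp
  obtain ⟨b, rfl⟩ : ∃ b, n = j + 1 + b := ⟨n - (j + 1), by omega⟩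
  set n := j + 1 + b with hn
  rw [show n + 1 + (j + 1) = n + j + 1 + 1 by ring, gaussBinom_succ_succ,
    gaussBinom_succ_succ', gaussBinom_succ_succ', show 2 * n - (n + j) = b + 1 by omega,
    show 2 * n - (n + j + 1) = b by omega, show n - j = b + 1 by omega,
    show n + (j + 1) = n + j + 1 by ring, show n + (j + 2) = n + j + 1 + 1 by ring]
  have : q ^ (2 * n + 1) = q ^ (n + j + 1 + 1) * q ^ b := by
    rw [← pow_add]; congr 1; omega
  rw [this]
  ring

/-- Induction on `n`. Passing from row `2n` to row `2n + 2` changes the `m`-th summand by `f m - f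
(m + 1)`, where `f m = q^(6m²+n) [2n, n+3m]`, so the total change telescopes to `f 0 = q^n [2n, n]`.
-/
theorem sum_pow_mul_gaussBinom_central (n : ℕ) :
    ∑ k ∈ Finset.range n, q ^ k * gaussBinom q (2 * k) k =
      ∑ m ∈ Finset.range n, (q ^ (6 * m ^ 2 + 3 * m) * gaussBinom q (2 * n) (n + (3 * m + 1)) -
        q ^ (6 * m ^ 2 + 9 * m + 3) * gaussBinom q (2 * n) (n + (3 * m + 2))) := by
  induction n with
  | zero => simp
  | succ n ih =>
    have hext : ∑ m ∈ Finset.range n,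
        (q ^ (6 * m ^ 2 + 3 * m) * gaussBinom q (2 * n) (n + (3 * m + 1)) -
          q ^ (6 * m ^ 2 + 9 * m + 3) * gaussBinom q (2 * n) (n + (3 * m + 2))) =
        ∑ m ∈ Finset.range (n + 1),
        (q ^ (6 * m ^ 2 + 3 * m) * gaussBinom q (2 * n) (n + (3 * m + 1)) -
          q ^ (6 * m ^ 2 + 9 * m + 3) * gaussBinom q (2 * n) (n + (3 * m + 2))) := by
      rw [Finset.sum_range_succ, gaussBinom_eq_zero_of_lt q (show 2 * n < n + (3 * n + 1) by omega),
        gaussBinom_eq_zero_of_lt q (show 2 * n < n + (3 * n + 2) by omega)]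
      simp
    have htel := Finset.sum_range_sub'
      (fun m => q ^ (6 * m ^ 2 + n) * gaussBinom q (2 * n) (n + 3 * m)) (n + 1)
    rw [gaussBinom_eq_zero_of_lt q (show 2 * n < n + 3 * (n + 1) by omega)] at htel
    rw [Finset.sum_range_succ, ih, hext]
    have h0 : q ^ n * gaussBinom q (2 * n) n =
        q ^ (6 * 0 ^ 2 + n) * gaussBinom q (2 * n) (n + 3 * 0) - q ^ (6 * (n + 1) ^ 2 + n) * 0 := by
      simp
    rw [h0, ← htel, ← Finset.sum_add_distrib]
    refine Finset.sum_congr rfl fun m _ => ?_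
    have e1 := gaussBinom_two_step q n (3 * m)
    have e2 := gaussBinom_two_step q n (3 * m + 1)
    have e3 := gaussBinom_mul_one_sub_right q (2 * n) (n + (3 * m + 1))
    simp only [show 2 * (n + 1) = 2 * n + 2 by ring, show n + (3 * (m + 1)) = n + (3 * m + 3) by ring,
      show 3 * m + 1 + 1 = 3 * m + 2 by ring, show 3 * m + 1 + 2 = 3 * m + 3 by ring,
      show n + (3 * m + 1) + 1 = n + (3 * m + 2) by ring] at *
    rw [e1, e2]
    have f1 : q ^ (3 * m) * (q ^ (n - 3 * m) * gaussBinom q (2 * n) (n + 3 * m)) =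
        q ^ n * gaussBinom q (2 * n) (n + 3 * m) := by
      rcases lt_or_ge n (3 * m) with h | h
      · rw [gaussBinom_eq_zero_of_lt q (show 2 * n < n + 3 * m by omega)]; simp
      · rw [← mul_assoc, ← pow_add, show 3 * m + (n - 3 * m) = n by omega]
    have f2 : q ^ (3 * m + 1) *
        (q ^ (n - (3 * m + 1)) * gaussBinom q (2 * n) (n + (3 * m + 1))) =
        q ^ n * gaussBinom q (2 * n) (n + (3 * m + 1)) := by
      rcases lt_or_ge n (3 * m + 1) with h | h
      · rw [gaussBinom_eq_zero_of_lt q (show 2 * n < n + (3 * m + 1) by omega)]; simp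
      · rw [← mul_assoc, ← pow_add, show 3 * m + 1 + (n - (3 * m + 1)) = n by omega]
    rw [show 2 * n - (n + (3 * m + 1)) = n - (3 * m + 1) by omega] at e3
    rw [show q ^ (n + (3 * m + 2)) = q ^ n * q ^ (3 * m) * q ^ 2 by ring] at e3
    rw [show q ^ (3 * m + 1) = q ^ (3 * m) * q by ring] at f2
    rw [show q ^ (6 * m ^ 2 + n) = q ^ (6 * m ^ 2) * q ^ n by ring,
      show q ^ (6 * (m + 1) ^ 2 + n) = q ^ (6 * m ^ 2) * (q ^ (3 * m)) ^ 4 * q ^ 6 * q ^ n by ring,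
      show q ^ (6 * m ^ 2 + 3 * m) = q ^ (6 * m ^ 2) * q ^ (3 * m) by ring,
      show q ^ (6 * m ^ 2 + 9 * m + 3) = q ^ (6 * m ^ 2) * (q ^ (3 * m)) ^ 3 * q ^ 3 by ring,
      show q ^ (2 * n + 1) = (q ^ n) ^ 2 * q by ring,
      show q ^ (n + 2 + 3 * m) = q ^ n * q ^ 2 * q ^ (3 * m) by ring,
      show q ^ (n + 2 + (3 * m + 1)) = q ^ n * q ^ 3 * q ^ (3 * m) by ring]
    linear_combination -q ^ (6 * m ^ 2) * f1 +
      q ^ (6 * m ^ 2) * (q ^ (3 * m)) ^ 2 * q ^ 2 * f2 -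
      q ^ (6 * m ^ 2) * q ^ (3 * m) * q ^ n * q * (q ^ (3 * m) * q * e3 - f2)

end GaussBinom

/-! ### Values of rational functions in a commutative ring -/

section Evaluation

variable {R : Type*} [CommRing R]

/-- The rational function `A` is regular at `q`, with value `a`. -/
def EvaluatesTo (q : R) (A : RatFunc ℤ) (a : R) : Prop :=
  ∃ p d : ℤ[X], A * algebraMap ℤ[X] (RatFunc ℤ) d = algebraMap ℤ[X] (RatFunc ℤ) p ∧
    IsUnit (aeval q d) ∧ aeval q p = a * aeval q d

namespace EvaluatesTo

variable {q : R} {A B : RatFunc ℤ} {a b : R}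

theorem of_polynomial (q : R) (p : ℤ[X]) :
    EvaluatesTo q (algebraMap ℤ[X] (RatFunc ℤ) p) (aeval q p) :=
  ⟨p, 1, by simp, by simp, by simp⟩

theorem X (q : R) : EvaluatesTo q RatFunc.X q := by
  simpa using EvaluatesTo.of_polynomial q (Polynomial.X)

theorem intCast (q : R) (z : ℤ) : EvaluatesTo q (z : RatFunc ℤ) (z : R) := by
  simpa using EvaluatesTo.of_polynomial q (Int.cast z)

theorem one (q : R) : EvaluatesTo q 1 1 := by
  simpa using EvaluatesTo.of_polynomial q 1

theorem zero (q : R) : EvaluatesTo q 0 0 := by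
  simpa using EvaluatesTo.of_polynomial q 0

theorem mul (hA : EvaluatesTo q A a) (hB : EvaluatesTo q B b) : EvaluatesTo q (A * B) (a * b) := by
  obtain ⟨p, d, h1, h2, h3⟩ := hA
  obtain ⟨p', d', h1', h2', h3'⟩ := hB
  refine ⟨p * p', d * d', ?_, by simpa using h2.mul h2', ?_⟩
  · rw [map_mul, map_mul, ← h1, ← h1']; ring
  · rw [map_mul, map_mul, h3, h3']; ring

theorem add (hA : EvaluatesTo q A a) (hB : EvaluatesTo q B b) : EvaluatesTo q (A + B) (a + b) := by
  obtain ⟨p, d, h1, h2, h3⟩ := hA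
  obtain ⟨p', d', h1', h2', h3'⟩ := hB
  refine ⟨p * d' + p' * d, d * d', ?_, by simpa using h2.mul h2', ?_⟩
  · simp only [map_mul, map_add, ← h1, ← h1']; ring
  · simp only [map_mul, map_add, h3, h3']; ring

theorem neg (hA : EvaluatesTo q A a) : EvaluatesTo q (-A) (-a) := by
  simpa using (intCast q (-1)).mul hA

theorem sub (hA : EvaluatesTo q A a) (hB : EvaluatesTo q B b) : EvaluatesTo q (A - B) (a - b) := by
  simpa [sub_eq_add_neg] using hA.add hB.neg

theorem pow (hA : EvaluatesTo q A a) (k : ℕ) : EvaluatesTo q (A ^ k) (a ^ k) := by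
  induction k with
  | zero => simpa using one q
  | succ k ih => simpa [pow_succ] using ih.mul hA

theorem sum {ι : Type*} (s : Finset ι) {F : ι → RatFunc ℤ} {f : ι → R}
    (h : ∀ i ∈ s, EvaluatesTo q (F i) (f i)) :
    EvaluatesTo q (∑ i ∈ s, F i) (∑ i ∈ s, f i) := by
  classical
  induction s using Finset.induction_on with
  | empty => simpa using zero q
  | insert i s hi ih =>
    rw [Finset.sum_insert hi, Finset.sum_insert hi]
    exact (h i (Finset.mem_insert_self _ _)).add
      (ih fun j hj => h j (Finset.mem_insert_of_mem hj))

theorem prod {ι : Type*} (s : Finset ι) {F : ι → RatFunc ℤ} {f : ι → R}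
    (h : ∀ i ∈ s, EvaluatesTo q (F i) (f i)) :
    EvaluatesTo q (∏ i ∈ s, F i) (∏ i ∈ s, f i) := by
  classical
  induction s using Finset.induction_on with
  | empty => simpa using one q
  | insert i s hi ih =>
    rw [Finset.prod_insert hi, Finset.prod_insert hi]
    exact (h i (Finset.mem_insert_self _ _)).mul
      (ih fun j hj => h j (Finset.mem_insert_of_mem hj))

theorem inv [Nontrivial R] (hA : EvaluatesTo q A a) (ha : IsUnit a) :
    EvaluatesTo q A⁻¹ (Ring.inverse a) := by
  obtain ⟨p, d, h1, h2, h3⟩ := hA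
  have hp : IsUnit (aeval q p) := h3 ▸ ha.mul h2
  have hp0 : algebraMap ℤ[X] (RatFunc ℤ) p ≠ 0 := by
    intro h
    rw [(map_eq_zero_iff _ (IsFractionRing.injective ℤ[X] (RatFunc ℤ))).1 h, map_zero] at hp
    exact not_isUnit_zero hp
  have hA0 : A ≠ 0 := by
    rintro rfl
    exact hp0 (by rw [← h1, zero_mul])
  refine ⟨d, p, ?_, hp, ?_⟩
  · rw [← h1]; field_simp
  · rw [h3, ← mul_assoc, Ring.inverse_mul_cancel _ ha, one_mul]

theorem div [Nontrivial R] (hA : EvaluatesTo q A a) (hB : EvaluatesTo q B b) (hb : IsUnit b) :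
    EvaluatesTo q (A / B) (a * Ring.inverse b) := by
  rw [div_eq_mul_inv]; exact hA.mul (hB.inv hb)

theorem qShiftedFactorial (hA : EvaluatesTo q A a) (hB : EvaluatesTo q B b) (k : ℕ) :
    EvaluatesTo q (qShiftedFactorial A B k) (qShiftedFactorial a b k) :=
  prod _ fun i _ => (one q).sub (hA.mul (hB.pow i))

theorem gaussBinom (hA : EvaluatesTo q A a) (M k : ℕ) :
    EvaluatesTo q (gaussBinom A M k) (gaussBinom a M k) := by
  induction M generalizing k with
  | zero =>
    cases k with
    | zero => simpa using one q
    | succ k => simpa using zero q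
  | succ M ih =>
    cases k with
    | zero => simpa using one q
    | succ k =>
      rw [gaussBinom_succ_succ, gaussBinom_succ_succ]
      exact (ih k).add ((hA.pow _).mul (ih _))

/-- Cross-multiplying `p / d` with the reduced fraction gives `num * d = p * den`. Since `d` takes a
unit value at `q`, it can be cancelled even in a ring with zero divisors, and nothing need be known
about the value of `den`. -/
theorem aeval_num_eq_zero (h : EvaluatesTo q A 0) :
    aeval q (IsFractionRing.num ℤ[X] A) = 0 := by
  obtain ⟨p, d, h1, h2, h3⟩ := h
  have hA : A * algebraMap ℤ[X] (RatFunc ℤ) (IsFractionRing.den ℤ[X] A) =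
      algebraMap ℤ[X] (RatFunc ℤ) (IsFractionRing.num ℤ[X] A) := by
    conv_lhs => enter [1]; rw [← IsFractionRing.mk'_num_den ℤ[X] A]
    exact IsLocalization.mk'_spec _ _ _
  have key : IsFractionRing.num ℤ[X] A * d = p * IsFractionRing.den ℤ[X] A := by
    apply IsFractionRing.injective ℤ[X] (RatFunc ℤ)
    rw [map_mul, map_mul, ← h1, ← hA]; ring
  have := congrArg (aeval q) key
  rw [map_mul, map_mul, h3, zero_mul, zero_mul] at this
  exact h2.mul_left_eq_zero.1 this

end EvaluatesTo

end Evaluation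

theorem qBinomialCoeff_eq_gaussBinom {K : Type*} [Field K] {q : K} (hq : ∀ i : ℕ, q ^ (i + 1) ≠ 1)
    (M N : ℕ) : qBinomialCoeff q M N = gaussBinom q M N := by
  have h0 : ∀ k, qShiftedFactorial q q k ≠ 0 := fun k =>
    Finset.prod_ne_zero_iff.2 fun i _ => by
      rw [← pow_succ']; exact sub_ne_zero.2 (hq i).symm
  unfold qBinomialCoeff
  split_ifs with h
  · rw [div_eq_iff (mul_ne_zero (h0 _) (h0 _))]
    have := gaussBinom_mul_qShiftedFactorial q N (M - N)
    rw [Nat.add_sub_cancel' h] at this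
    exact this.symm
  · exact (gaussBinom_eq_zero_of_lt q (not_le.1 h)).symm

theorem RatFunc.X_pow_pow_succ_ne_one {n : ℕ} (hn : 0 < n) (i : ℕ) :
    ((RatFunc.X : RatFunc ℤ) ^ n) ^ (i + 1) ≠ 1 := by
  rw [← pow_mul, ← RatFunc.algebraMap_X, ← map_pow, Ne, ← map_one (algebraMap ℤ[X] (RatFunc ℤ)),
    (IsFractionRing.injective ℤ[X] (RatFunc ℤ)).eq_iff]
  intro h
  have := congrArg natDegree h
  rw [natDegree_X_pow, natDegree_one] at this
  exact absurd this (Nat.mul_ne_zero hn.ne' (Nat.succ_ne_zero _))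

theorem evaluatesTo_centralSum {R : Type*} [CommRing R] (q : R) {n : ℕ}
    (hn : 0 < n) (N : ℕ) :
    EvaluatesTo q (centralSum (RatFunc.X ^ n) N)
      (∑ k ∈ Finset.range (N + 1), (q ^ n) ^ k * gaussBinom (q ^ n) (2 * k) k) := by
  refine EvaluatesTo.sum _ fun k _ => ?_
  have hX := (EvaluatesTo.X q).pow n
  rw [qBinomialCoeff_eq_gaussBinom (RatFunc.X_pow_pow_succ_ne_one hn)]
  exact (hX.pow k).mul (hX.gaussBinom _ _)

theorem evaluatesTo_weightedCentralSum {R : Type*} [CommRing R] [Nontrivial R] (q : R) {n : ℕ}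
    (hn : 0 < n) (hu : ∀ k, IsUnit (qShiftedFactorial (-q ^ n) (q ^ n) k)) (N : ℕ) :
    EvaluatesTo q (weightedCentralSum (RatFunc.X ^ n) N)
      (∑ k ∈ Finset.range (N + 1), (q ^ n) ^ k *
        Ring.inverse (qShiftedFactorial (-q ^ n) (q ^ n) k) * gaussBinom (q ^ n) (2 * k) k) := by
  refine EvaluatesTo.sum _ fun k _ => ?_
  have hX := (EvaluatesTo.X q).pow n
  rw [qBinomialCoeff_eq_gaussBinom (RatFunc.X_pow_pow_succ_ne_one hn)]
  exact ((hX.pow k).div (hX.neg.qShiftedFactorial hX k) (hu k)).mul (hX.gaussBinom _ _)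

/-! ### Divisibility by cyclotomic polynomials and by the modulus -/

theorem cyclotomic_dvd_of_aeval_eq_zero {N : ℕ} (hN : 0 < N) {ζ : ℂ} (hζ : IsPrimitiveRoot ζ N)
    {p : ℤ[X]} (hp : aeval ζ p = 0) : cyclotomic N ℤ ∣ p := by
  rw [cyclotomic_eq_minpoly hζ hN]
  exact minpoly.isIntegrallyClosed_dvd (hζ.isIntegral hN) hp

/-- By Taylor expansion `p(ζ + zε) = p(ζ) + z p'(ζ) ε`, so `ζ` is a double zero of `p`. As `Φ_N` is
separable over `ℂ`, the cofactor `p / Φ_N` still vanishes at `ζ`. -/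
theorem cyclotomic_sq_dvd_of_aeval_eq_zero {N : ℕ} (hN : 0 < N) {q : DualNumber ℂ}
    (hζ : IsPrimitiveRoot q.fst N) (hq : q.snd ≠ 0)
    {p : ℤ[X]} (hp : aeval q p = 0) : cyclotomic N ℤ ^ 2 ∣ p := by
  have key : ∀ s : ℤ[X], aeval q s =
      TrivSqZeroExt.inl (aeval q.fst s) + TrivSqZeroExt.inr (q.snd * aeval q.fst (derivative s)) := by
    intro s
    have h := aeval_add_of_sq_eq_zero s (TrivSqZeroExt.inl q.fst) (TrivSqZeroExt.inr q.snd)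
      (by rw [sq, TrivSqZeroExt.inr_mul_inr])
    have h1 : ∀ s : ℤ[X], aeval (TrivSqZeroExt.inl q.fst : DualNumber ℂ) s =
        TrivSqZeroExt.inl (aeval q.fst s) :=
      fun s => aeval_algHom_apply (TrivSqZeroExt.inlAlgHom ℤ ℂ ℂ) q.fst s
    rw [TrivSqZeroExt.inl_fst_add_inr_snd_eq, h1, h1, TrivSqZeroExt.inl_mul_inr] at h
    rw [h, smul_eq_mul, mul_comm]
  have h := key p
  rw [hp] at h
  have h1 : aeval q.fst p = 0 := by simpa using (congrArg TrivSqZeroExt.fst h).symm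
  have h2 : aeval q.fst (derivative p) = 0 := by
    have := congrArg TrivSqZeroExt.snd h
    simpa [hq] using this.symm
  obtain ⟨s, rfl⟩ := cyclotomic_dvd_of_aeval_eq_zero hN hζ h1
  have hc : aeval q.fst (cyclotomic N ℤ) = 0 := by
    have := hζ.isRoot_cyclotomic hN
    rw [IsRoot.def, ← map_cyclotomic_int, eval_map] at this
    simpa [aeval_def] using this
  have hc' : aeval q.fst (derivative (cyclotomic N ℤ)) ≠ 0 := by
    have hsep : (cyclotomic N ℂ).Separable := 
      haveI : NeZero (N : ℂ) := ⟨Nat.cast_ne_zero.2 hN.ne'⟩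
      separable_cyclotomic N ℂ
    have := hsep.aeval_derivative_ne_zero (x := q.fst) (by
      rwa [← map_cyclotomic_int, aeval_def, eval₂_map])
    rwa [← map_cyclotomic_int, derivative_map, aeval_def, eval₂_map] at this
  have h3 : aeval q.fst s = 0 := by
    rw [derivative_mul, map_add, map_mul, map_mul, hc, zero_mul, add_zero] at h2
    exact (mul_eq_zero.1 h2).resolve_left hc'
  obtain ⟨u, rfl⟩ := cyclotomic_dvd_of_aeval_eq_zero hN hζ h3
  exact ⟨u, by ring⟩

/-- Distinct cyclotomic polynomials need not be comaximal over `ℤ` (as for indices differing by a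
prime power), but the absence of common factors is all that the product of divisors requires. -/
theorem isRelPrime_cyclotomic {a b : ℕ} (ha : 0 < a) (hb : 0 < b) (hab : a ≠ b) :
    IsRelPrime (cyclotomic a ℤ) (cyclotomic b ℤ) := by
  refine ((cyclotomic.irreducible ha).isRelPrime_iff_not_dvd).2 fun h => ?_
  obtain ⟨u, hu⟩ := h
  rcases (cyclotomic.irreducible hb).isUnit_or_isUnit hu with h | h
  · exact (cyclotomic.irreducible ha).not_isUnit h
  · have hassoc : Associated (cyclotomic a ℤ) (cyclotomic b ℤ) := ⟨h.unit, hu.symm⟩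
    have := eq_of_monic_of_associated (cyclotomic.monic a ℤ) (cyclotomic.monic b ℤ) hassoc
    exact hab (cyclotomic_injective this)

theorem dworkModulus_dvd {n r d : ℕ} (hn : 1 < n) (hr : 1 ≤ r) (hd : d = 1 ∨ d = 2) {p : ℤ[X]}
    (h : ∀ j, 1 ≤ j → j ≤ r → cyclotomic (n ^ j) ℤ ∣ p)
    (h2 : d = 1 → cyclotomic (n ^ r) ℤ ^ 2 ∣ p) : dworkModulus n r d ∣ p := by
  have hpos : ∀ j, 0 < n ^ j := fun j => Nat.pow_pos (by omega)
  have hrel : ∀ i j, i ≠ j → IsRelPrime (cyclotomic (n ^ i) ℤ) (cyclotomic (n ^ j) ℤ) :=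
    fun i j hij => isRelPrime_cyclotomic (hpos i) (hpos j)
      fun h => hij (Nat.pow_right_injective hn h)
  unfold dworkModulus
  rcases hd with rfl | rfl
  · obtain ⟨s, rfl⟩ : ∃ s, r = s + 1 := ⟨r - 1, by omega⟩
    rw [Finset.prod_Icc_succ_top (by omega), mul_comm, mul_assoc, ← pow_succ']
    refine IsRelPrime.mul_dvd ?_ (Finset.prod_dvd_of_isRelPrime ?_ ?_) (h2 rfl)
    · refine IsRelPrime.prod_left fun j hj => IsRelPrime.pow_right (hrel _ _ ?_)
      have := Finset.mem_Icc.1 hj; omega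
    · exact fun i _ j _ hij => hrel i j hij
    · intro j hj
      have := Finset.mem_Icc.1 hj
      exact h j this.1 (by omega)
  · simp only [Nat.sub_self, pow_zero, one_mul]
    refine Finset.prod_dvd_of_isRelPrime (fun i _ j _ hij => hrel i j hij) fun j hj => ?_
    have := Finset.mem_Icc.1 hj
    exact h j this.1 this.2

/-! ### The `q`-Lucas theorem at a root of unity -/

section RootOfUnity

variable {K : Type*} [Field K] {ζ : K} {N : ℕ}

theorem gaussBinom_order_eq_zero (hζ : IsPrimitiveRoot ζ N) {k : ℕ} (h0 : 0 < k) (hk : k < N) :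
    gaussBinom ζ N k = 0 := by
  obtain ⟨k, rfl⟩ : ∃ i, k = i + 1 := ⟨k - 1, by omega⟩
  obtain ⟨N, rfl⟩ : ∃ i, N = i + 1 := ⟨N - 1, by omega⟩
  have h := gaussBinom_succ_succ_mul_one_sub ζ N k
  rw [hζ.pow_eq_one, sub_self, zero_mul] at h
  exact (mul_eq_zero.1 h).resolve_left
    (sub_ne_zero.2 (hζ.pow_ne_one_of_pos_of_lt (Nat.succ_ne_zero _) hk).symm)

/-- The `q`-analogue of `(1+x)^(M+N) = (1+x)^M (1+x^N)`: row `N` is zero strictly between its ends,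
and `ζ^N = 1` lets the Pascal rule carry this pattern to later rows. -/
theorem gaussBinom_add_order (hζ : IsPrimitiveRoot ζ N) (hN : 0 < N) (M k : ℕ) :
    gaussBinom ζ (M + N) k =
      gaussBinom ζ M k + if N ≤ k then gaussBinom ζ M (k - N) else 0 := by
  induction M generalizing k with
  | zero =>
    rw [zero_add]
    rcases lt_trichotomy k N with h | rfl | h
    · rcases Nat.eq_zero_or_pos k with rfl | h0
      · simp [hN.ne']
      · rw [gaussBinom_order_eq_zero hζ h0 h, gaussBinom_eq_zero_of_lt ζ h0, if_neg (by omega),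
          add_zero]
    · simp [gaussBinom_eq_zero_of_lt ζ hN]
    · rw [gaussBinom_eq_zero_of_lt ζ h, gaussBinom_eq_zero_of_lt ζ (hN.trans h), if_pos h.le,
        gaussBinom_eq_zero_of_lt ζ (Nat.sub_pos_of_lt h), add_zero]
  | succ M ih =>
    cases k with
    | zero => simp [hN.ne']
    | succ k =>
      rw [show M + 1 + N = M + N + 1 by ring, gaussBinom_succ_succ, gaussBinom_succ_succ, ih, ih]
      rcases lt_trichotomy (k + 1) N with h | h | h
      · rw [if_neg (by omega), if_neg (by omega), if_neg (by omega)]; ring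
      · rw [if_neg (by omega), if_pos h.ge, if_pos h.ge, ← h]
        rw [h, hζ.pow_eq_one]
        simp; ring
      · rw [if_pos (by omega), if_pos h.le, if_pos h.le,
          show k + 1 - N = k - N + 1 by omega, gaussBinom_succ_succ,
          show k + 1 = k - N + 1 + N by omega, pow_add ζ (k - N + 1), hζ.pow_eq_one]
        ring

theorem gaussBinom_lucas (hζ : IsPrimitiveRoot ζ N) (a c : ℕ) {b d : ℕ} (hb : b < N) (hd : d < N) :
    gaussBinom ζ (a * N + b) (c * N + d) = (a.choose c : K) * gaussBinom ζ b d := by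
  have hN : 0 < N := by omega
  induction a generalizing c with
  | zero =>
    cases c with
    | zero => simp
    | succ c =>
      rw [gaussBinom_eq_zero_of_lt ζ (by nlinarith)]
      simp
  | succ a ih =>
    rw [show (a + 1) * N + b = a * N + b + N by ring, gaussBinom_add_order hζ hN, ih]
    cases c with
    | zero => simp [hd]
    | succ c =>
      rw [if_pos (by nlinarith), show (c + 1) * N + d - N = c * N + d by
        rw [add_mul, one_mul, Nat.add_right_comm, Nat.add_sub_cancel], ih, Nat.choose_succ_succ]
      push_cast
      ring

/-- Adding `b` to itself produces a carry, and the residue `2b - N` is less than `b`. Hence the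
upper half of each period contributes nothing, which makes the truncation `d = 2` possible. -/
theorem gaussBinom_central_eq_zero (hζ : IsPrimitiveRoot ζ N) {b : ℕ} (hb : b < N)
    (h : N ≤ 2 * b) : gaussBinom ζ (2 * b) b = 0 := by
  have := gaussBinom_lucas hζ 1 0 (b := 2 * b - N) (d := b) (by omega) hb
  rw [show 1 * N + (2 * b - N) = 2 * b by omega, zero_mul, zero_add,
    gaussBinom_eq_zero_of_lt ζ (show 2 * b - N < b by omega), mul_zero] at this
  exact this

theorem gaussBinom_central_lucas (hζ : IsPrimitiveRoot ζ N) (a : ℕ) {b : ℕ} (hb : b < N) :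
    gaussBinom ζ (2 * (a * N + b)) (a * N + b) =
      (a.centralBinom : K) * gaussBinom ζ (2 * b) b := by
  rcases lt_or_ge (2 * b) N with h | h
  · rw [show 2 * (a * N + b) = 2 * a * N + 2 * b by ring, gaussBinom_lucas hζ _ _ h hb]
    rfl
  · rw [show 2 * (a * N + b) = (2 * a + 1) * N + (2 * b - N) by
        zify [h]; ring, gaussBinom_lucas hζ _ _ (by omega) hb,
      gaussBinom_eq_zero_of_lt ζ (show 2 * b - N < b by omega),
      gaussBinom_central_eq_zero hζ hb h, mul_zero, mul_zero]

theorem gaussBinom_order_sub_one (hζ : IsPrimitiveRoot ζ N) {j : ℕ} (hj : j < N) :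
    ζ ^ (j * (j + 1) / 2) * gaussBinom ζ (N - 1) j = (-1) ^ j := by
  induction j with
  | zero => simp
  | succ j ih =>
    have h := gaussBinom_order_eq_zero hζ (Nat.succ_pos j) hj
    obtain ⟨N, rfl⟩ : ∃ i, N = i + 1 := ⟨N - 1, by omega⟩
    rw [Nat.succ_eq_add_one, gaussBinom_succ_succ] at h
    rw [Nat.add_sub_cancel] at ih ⊢
    have e : (j + 1) * (j + 1 + 1) / 2 = j * (j + 1) / 2 + (j + 1) := by
      rw [show (j + 1) * (j + 1 + 1) = j * (j + 1) + (j + 1) * 2 by ring,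
        Nat.add_mul_div_right _ _ two_pos]
    have := ih (by omega)
    rw [e, pow_add, pow_succ (-1 : K)]
    linear_combination ζ ^ (j * (j + 1) / 2) * h - this

/-- The first `N - 1` factors multiply to `(ζ²;ζ²)_{N-1} / (ζ;ζ)_{N-1} = N / N = 1`, because `ζ²` is
again primitive for odd `N`. The last factor is `1 + ζ^N = 2`. -/
theorem qShiftedFactorial_neg_order [CharZero K] (hζ : IsPrimitiveRoot ζ N) (hN : Odd N) :
    qShiftedFactorial (-ζ) ζ N = 2 := by
  obtain ⟨m, rfl⟩ := hN
  have h1 : ∀ {μ : K}, IsPrimitiveRoot μ (2 * m + 1) →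
      qShiftedFactorial μ μ (2 * m) = (2 * m : ℕ) + 1 := by
    intro μ hμ
    rw [← hμ.prod_one_sub_pow_eq_order]
    exact Finset.prod_congr rfl fun i _ => by rw [pow_succ']
  have h2 : qShiftedFactorial (ζ ^ 2) (ζ ^ 2) (2 * m) =
      qShiftedFactorial ζ ζ (2 * m) * qShiftedFactorial (-ζ) ζ (2 * m) := by
    unfold qShiftedFactorial
    rw [← Finset.prod_mul_distrib]
    exact Finset.prod_congr rfl fun i _ => by ring
  have hζ2 : IsPrimitiveRoot (ζ ^ 2) (2 * m + 1) :=
    hζ.pow_of_coprime 2 (by simp)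
  rw [h1 hζ, h1 hζ2] at h2
  have h0 : ((2 * m : ℕ) : K) + 1 ≠ 0 := Nat.cast_add_one_ne_zero _
  have h3 : qShiftedFactorial (-ζ) ζ (2 * m) = 1 := by
    apply mul_left_cancel₀ h0; rw [← h2, mul_one]
  rw [qShiftedFactorial_succ, h3, neg_mul, ← pow_succ', hζ.pow_eq_one]
  norm_num

theorem qShiftedFactorial_neg_lucas [CharZero K] (hζ : IsPrimitiveRoot ζ N) (hN : Odd N)
    (a b : ℕ) :
    qShiftedFactorial (-ζ) ζ (a * N + b) = 2 ^ a * qShiftedFactorial (-ζ) ζ b := by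
  induction a with
  | zero => simp
  | succ a ih =>
    have h : ∀ M, qShiftedFactorial (-ζ) ζ (N + M) = 2 * qShiftedFactorial (-ζ) ζ M := by
      intro M
      rw [← qShiftedFactorial_neg_order hζ hN]
      unfold qShiftedFactorial
      rw [Finset.prod_range_add]
      simp [pow_add, hζ.pow_eq_one]
    rw [show (a + 1) * N + b = N + (a * N + b) by ring, h, ih]
    ring

theorem qShiftedFactorial_neg_ne_zero [CharZero K] (hζ : IsPrimitiveRoot ζ N) (hN : Odd N) (k : ℕ) :
    qShiftedFactorial (-ζ) ζ k ≠ 0 := by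
  refine Finset.prod_ne_zero_iff.2 fun i _ h => ?_
  have h1 : ζ ^ (i + 1) = -1 := by rw [pow_succ']; linear_combination h
  have h2 : (ζ ^ (i + 1)) ^ N = 1 := by rw [← pow_mul, mul_comm, pow_mul, hζ.pow_eq_one, one_pow]
  rw [h1, hN.neg_one_pow] at h2
  norm_num at h2

end RootOfUnity

/-! ### Factoring sums over periods -/

section BlockSums

variable {A : Type*} [CommRing A] {N : ℕ} {F u v : ℕ → A}

theorem sum_range_mul_of_factor (hF : ∀ a b, b < N → F (a * N + b) = u a * v b) (c : ℕ) :
    ∑ k ∈ Finset.range (c * N), F k =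
      (∑ a ∈ Finset.range c, u a) * ∑ b ∈ Finset.range N, v b := by
  induction c with
  | zero => simp
  | succ c ih =>
    rw [add_mul, one_mul, Finset.sum_range_add, ih, Finset.sum_range_succ, add_mul,
      Finset.mul_sum _ _ (u c)]
    congr 1
    exact Finset.sum_congr rfl fun b hb => hF c b (Finset.mem_range.1 hb)

theorem sum_range_truncated_of_factor (hF : ∀ a b, b < N → F (a * N + b) = u a * v b)
    (hv : ∀ b, b < N → N ≤ 2 * b → v b = 0) {c d : ℕ} (hc : 0 < c) (hN : 0 < N)
    (hd : d = 1 ∨ d = 2 ∧ Odd c ∧ Odd N) :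
    ∑ k ∈ Finset.range ((c * N - 1) / d + 1), F k =
      (∑ a ∈ Finset.range ((c - 1) / d + 1), u a) * ∑ b ∈ Finset.range N, v b := by
  rcases hd with rfl | ⟨rfl, ⟨a, rfl⟩, ⟨m, rfl⟩⟩
  · have := Nat.mul_pos hc hN
    rw [Nat.div_one, Nat.div_one, Nat.sub_add_cancel this, Nat.sub_add_cancel hc]
    exact sum_range_mul_of_factor hF c
  · rw [Nat.add_sub_cancel, Nat.mul_div_cancel_left _ two_pos,
      show (2 * a + 1) * (2 * m + 1) - 1 = 2 * (a * (2 * m + 1) + m) by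
        rw [show (2 * a + 1) * (2 * m + 1) = 2 * (a * (2 * m + 1) + m) + 1 by ring]; rfl,
      Nat.mul_div_cancel_left _ two_pos, ← sum_range_mul_of_factor hF (a + 1)]
    -- The half-length sum stops at residue `m` of the last block; the `m` indices added to complete
    -- it have residue above `N / 2`, where `v` is zero.
    have hle : a * (2 * m + 1) + m + 1 + m = (a + 1) * (2 * m + 1) := by ring
    rw [← hle, Finset.sum_range_add F (a * (2 * m + 1) + m + 1) m]
    rw [Finset.sum_eq_zero (s := Finset.range m), add_zero]
    intro i hi
    have := Finset.mem_range.1 hi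
    rw [add_assoc, add_assoc, hF _ _ (by omega), hv _ (by omega) (by omega), mul_zero]

end BlockSums

theorem sum_central_primitiveRoot {K : Type*} [Field K] {ζ : K} {N c d : ℕ}
    (hζ : IsPrimitiveRoot ζ N) (hc : 0 < c) (hN : 0 < N) (hd : d = 1 ∨ d = 2 ∧ Odd c ∧ Odd N) :
    ∑ k ∈ Finset.range ((c * N - 1) / d + 1), ζ ^ k * gaussBinom ζ (2 * k) k =
      (∑ a ∈ Finset.range ((c - 1) / d + 1), (a.centralBinom : K)) *
        ∑ k ∈ Finset.range N, ζ ^ k * gaussBinom ζ (2 * k) k := by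
  refine sum_range_truncated_of_factor (fun a b hb => ?_) (fun b hb h => ?_) hc hN hd
  · rw [gaussBinom_central_lucas hζ a hb, pow_add, mul_comm a N, pow_mul, hζ.pow_eq_one]
    ring
  · rw [gaussBinom_central_eq_zero hζ hb h, mul_zero]

theorem sum_weightedCentral_primitiveRoot {K : Type*} [Field K] [CharZero K] {ζ : K} {N c d : ℕ}
    (hζ : IsPrimitiveRoot ζ N) (hc : 0 < c) (hN : Odd N) (hd : d = 1 ∨ d = 2 ∧ Odd c ∧ Odd N) :
    ∑ k ∈ Finset.range ((c * N - 1) / d + 1),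
        ζ ^ k * Ring.inverse (qShiftedFactorial (-ζ) ζ k) * gaussBinom ζ (2 * k) k =
      (∑ a ∈ Finset.range ((c - 1) / d + 1), (a.centralBinom : K) / 2 ^ a) *
        ∑ k ∈ Finset.range N,
          ζ ^ k * Ring.inverse (qShiftedFactorial (-ζ) ζ k) * gaussBinom ζ (2 * k) k := by
  refine sum_range_truncated_of_factor (fun a b hb => ?_) (fun b hb h => ?_) hc hN.pos hd
  · rw [gaussBinom_central_lucas hζ a hb, pow_add, mul_comm a N, pow_mul, hζ.pow_eq_one,
      mul_comm N a, qShiftedFactorial_neg_lucas hζ hN, Ring.inverse_eq_inv', mul_inv]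
    ring
  · rw [gaussBinom_central_eq_zero hζ hb h, mul_zero]

/-! ### The weighted sum over one period at a dual number -/

theorem DualNumber.mul_eq_mul_of_fst_eq {K : Type*} [CommRing K] {x y δ : DualNumber K}
    (h : x.fst = y.fst) (hδ : δ.fst = 0) : x * δ = y * δ := by
  ext <;> simp [h, hδ]

theorem DualNumber.sq_eq_zero_of_fst_eq_zero {K : Type*} [CommRing K] {δ : DualNumber K}
    (hδ : δ.fst = 0) : δ ^ 2 = 0 := by
  rw [sq]; ext <;> simp [hδ]

theorem one_add_pow_of_sq_eq_zero {R : Type*} [CommRing R] {δ : R} (hδ : δ ^ 2 = 0) (k : ℕ) :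
    (1 + δ) ^ k = 1 + k * δ := by
  induction k with
  | zero => simp
  | succ k ih => rw [pow_succ, ih]; push_cast; linear_combination (k : R) * hδ

section Cauchy

variable {R : Type*} [CommRing R]

/-- The Newton expansion of `y^l` at the nodes `1, u, u², …`. The induction multiplies by `y = (y -
u^k) + u^k` and applies the Pascal rule. -/
theorem sum_gaussBinom_mul_prod_sub_pow (u y : R) (l : ℕ) :
    ∑ k ∈ Finset.range (l + 1), gaussBinom u l k * ∏ i ∈ Finset.range k, (y - u ^ i) = y ^ l := by
  induction l with
  | zero => simp
  | succ l ih =>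
    rw [Finset.sum_range_succ']
    simp only [gaussBinom_succ_succ, add_mul, Finset.sum_add_distrib]
    have h2 : ∑ k ∈ Finset.range (l + 1), u ^ (k + 1) * gaussBinom u l (k + 1) *
          ∏ i ∈ Finset.range (k + 1), (y - u ^ i) +
        gaussBinom u (l + 1) 0 * ∏ i ∈ Finset.range 0, (y - u ^ i) =
        ∑ k ∈ Finset.range (l + 1), u ^ k * gaussBinom u l k *
          ∏ i ∈ Finset.range k, (y - u ^ i) := by
      rw [Finset.sum_range_succ, gaussBinom_eq_zero_of_lt u (Nat.lt_succ_self l),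
        Finset.sum_range_succ' _ l]
      simp
    rw [add_assoc, h2, ← Finset.sum_add_distrib, pow_succ, ← ih, Finset.sum_mul]
    refine Finset.sum_congr rfl fun k _ => ?_
    rw [Finset.prod_range_succ]
    ring

theorem qShiftedFactorial_inv_pow {u q : R} (h : u * q = 1) (l k : ℕ) :
    qShiftedFactorial (u ^ l) q k = gaussBinom u l k * qShiftedFactorial u u k := by
  induction k with
  | zero => simp
  | succ k ih =>
    rw [qShiftedFactorial_succ, qShiftedFactorial_succ, ih]
    have h1 := gaussBinom_mul_one_sub_right u l k
    rcases lt_or_ge l k with hlt | hge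
    · rw [gaussBinom_eq_zero_of_lt u hlt, gaussBinom_eq_zero_of_lt u (show l < k + 1 by omega)]
      simp
    · have h2 : u ^ l * q ^ k = u ^ (l - k) := by
        rw [← Nat.sub_add_cancel hge, pow_add, Nat.sub_add_cancel hge, mul_assoc, ← mul_pow, h,
          one_pow, mul_one]
      rw [h2]
      linear_combination -qShiftedFactorial u u k * h1

/-- A polynomial taking the value `y ^ l` at `u ^ l` for `l < n`, where `u` is the inverse
of `q`. -/
noncomputable def cauchyPoly (u q y : R) (n : ℕ) : R[X] :=
  ∑ k ∈ Finset.range n,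
    C ((∏ i ∈ Finset.range k, (y - u ^ i)) * Ring.inverse (qShiftedFactorial u u k)) *
      ∏ i ∈ Finset.range k, (1 - X * C (q ^ i))

theorem eval_cauchyPoly (u q y x : R) (n : ℕ) :
    (cauchyPoly u q y n).eval x = ∑ k ∈ Finset.range n, (∏ i ∈ Finset.range k, (y - u ^ i)) *
      Ring.inverse (qShiftedFactorial u u k) * qShiftedFactorial x q k := by
  simp only [cauchyPoly, eval_finsetSum, eval_mul, eval_C, eval_prod, eval_sub, eval_one, eval_X,
    qShiftedFactorial]

theorem eval_cauchyPoly_pow {u q : R} (h : u * q = 1) (y : R) {n l : ℕ} (hl : l < n)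
    (hu : ∀ k < n, IsUnit (qShiftedFactorial u u k)) :
    (cauchyPoly u q y n).eval (u ^ l) = y ^ l := by
  rw [eval_cauchyPoly, ← sum_gaussBinom_mul_prod_sub_pow u y l]
  symm
  refine Finset.sum_subset_zero_on_sdiff (Finset.range_subset_range.2 hl) ?_ ?_
  · intro k hk
    rw [Finset.mem_sdiff, Finset.mem_range, Finset.mem_range] at hk
    rw [qShiftedFactorial_inv_pow h, gaussBinom_eq_zero_of_lt u (show l < k by omega)]
    simp
  · intro k hk
    rw [Finset.mem_range] at hk
    rw [qShiftedFactorial_inv_pow h]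
    have := Ring.inverse_mul_cancel _ (hu k (by omega))
    linear_combination -(gaussBinom u l k * ∏ i ∈ Finset.range k, (y - u ^ i)) * this

theorem natDegree_cauchyPoly_lt (u q y : R) {n : ℕ} (hn : 0 < n) :
    (cauchyPoly u q y n).natDegree < n := by
  refine lt_of_le_of_lt (natDegree_sum_le_of_forall_le (n := n - 1) _ _ fun k hk => ?_) (by omega)
  rw [Finset.mem_range] at hk
  refine (natDegree_C_mul_le _ _).trans ((natDegree_prod_le _ _).trans ?_)
  have : ∀ i ∈ Finset.range k, (1 - X * C (q ^ i) : R[X]).natDegree ≤ 1 := fun i _ => by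
    compute_degree
  refine (Finset.sum_le_sum this).trans ?_
  simp
  omega

end Cauchy

/-- The prescribed values are invariant under `x ↦ ω²/x` up to a monomial factor, so `P` is
palindromic after scaling: `a_i ω^i = a_{n-1-i} ω^(n-1-i)`, with `n = 2m + 1`. The weights in `P(ω)
= ∑ a_i ω^i` are thus symmetric about `i = m`, and the logarithmic derivative at `ω` is their mean
index `m`. -/
theorem two_mul_derivative_eval_of_interpolation {K : Type*} [Field K] {ω : K} {m : ℕ}
    (hω : IsPrimitiveRoot ω (2 * m + 1)) {P : K[X]} (hdeg : P.natDegree < 2 * m + 1)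
    (hP : ∀ s, 1 ≤ s → s ≤ 2 * m + 1 → P.eval (ω ^ (2 * s)) = (-ω) ^ (2 * m + 1 - s)) :
    2 * (ω * (derivative P).eval ω) = 2 * m * P.eval ω := by
  set n := 2 * m + 1 with hn
  have hω2 : IsPrimitiveRoot (ω ^ 2) n := hω.pow_of_coprime 2 (by simp [hn])
  have hω1 : ω ^ n = 1 := hω.pow_eq_one
  -- This is `ω x^(n-1) P(ω²/x)`. It agrees with `P` at all `n` powers of `ω²`, and both have degree
  -- below `n`.
  let Q : K[X] := ∑ i ∈ Finset.range n,
    C (P.coeff (n - 1 - i) * ω ^ (2 * (n - 1 - i) + 1)) * X ^ i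
  have hQdeg : Q.degree < n := by
    refine (degree_sum_le _ _).trans_lt ?_
    refine (Finset.sup_lt_iff (WithBot.bot_lt_coe n)).2 fun i hi => ?_
    exact (degree_C_mul_X_pow_le _ _).trans_lt (WithBot.coe_lt_coe.2 (Finset.mem_range.1 hi))
  have hPdeg : P.degree < n := lt_of_le_of_lt degree_le_natDegree (by exact_mod_cast hdeg)
  have hPQ : P = Q := by
    refine eq_of_degrees_lt_of_eval_index_eq (v := fun s => ω ^ (2 * s)) (Finset.Icc 1 n) ?_
      (by simpa using hPdeg) (by simpa using hQdeg) ?_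
    · intro a ha b hb hab
      simp only [pow_mul, Finset.coe_Icc, Set.mem_Icc] at ha hb hab
      obtain ⟨a, rfl⟩ : ∃ i, a = i + 1 := ⟨a - 1, by omega⟩
      obtain ⟨b, rfl⟩ : ∃ i, b = i + 1 := ⟨b - 1, by omega⟩
      rw [pow_succ _ a, pow_succ _ b] at hab
      have h0 : ω ^ 2 ≠ 0 := hω2.ne_zero (by omega)
      rw [hω2.pow_inj (i := a) (j := b) (by omega) (by omega) (mul_right_cancel₀ h0 hab)]
    · intro s hs
      rw [Finset.mem_Icc] at hs
      obtain ⟨l, hl⟩ : ∃ l, n = s + l := ⟨n - s, by omega⟩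
      have h1 := hP (l + 1) (by omega) (by omega)
      rw [eval_eq_sum_range' hdeg, show n - (l + 1) = s - 1 by omega] at h1
      rw [hP s hs.1 hs.2, show n - s = l by omega]
      have h2 : Q.eval (ω ^ (2 * s)) =
          ω ^ (2 * l + 1) * ∑ i ∈ Finset.range n, P.coeff i * (ω ^ (2 * (l + 1))) ^ i := by
        rw [← Finset.sum_range_reflect, Finset.mul_sum]
        simp only [Q, eval_finsetSum, eval_mul, eval_C, eval_pow, eval_X]
        refine Finset.sum_congr rfl fun i hi => ?_
        have hi := Finset.mem_range.1 hi
        obtain ⟨j, hj⟩ : ∃ j, n = i + j + 1 := ⟨n - i - 1, by omega⟩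
        rw [show n - 1 - i = j by omega]
        have h3 : ω ^ (2 * j + 1) * (ω ^ (2 * s)) ^ i = ω ^ (2 * l + 1) * (ω ^ (2 * (l + 1))) ^ j := by
          have e1 : (ω ^ n) ^ (2 * i) = 1 := by rw [hω1, one_pow]
          have e2 : (ω ^ n) ^ (2 * l) = 1 := by rw [hω1, one_pow]
          calc ω ^ (2 * j + 1) * (ω ^ (2 * s)) ^ i
              = ω ^ (2 * j + 1) * (ω ^ (2 * s)) ^ i * (ω ^ n) ^ (2 * l) := by rw [e2, mul_one]
            _ = ω ^ (2 * l + 1) * (ω ^ (2 * (l + 1))) ^ j * (ω ^ n) ^ (2 * i) := by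
                rw [← pow_mul, ← pow_mul, ← pow_mul, ← pow_mul, ← pow_add, ← pow_add, ← pow_add,
                  ← pow_add]
                congr 1
                have hsl : s + l = i + j + 1 := by omega
                have hs' : s = i + j + 1 - l := by omega
                zify [show l ≤ i + j + 1 by omega] at hs' ⊢
                rw [hj, hs']; push_cast; ring
            _ = _ := by rw [e1, mul_one]
        rw [mul_assoc, h3]; ring
      rw [h2, h1]
      have e3 : (-ω) ^ (2 * m) = ω ^ (2 * m) := by rw [pow_mul, pow_mul, neg_sq]
      have e4 : (-1 : K) ^ (s - 1) = (-1) ^ l := by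
        have : s - 1 + l = 2 * m := by omega
        have h : (-1 : K) ^ (s - 1) * (-1) ^ l = 1 := by
          rw [← pow_add, this, pow_mul]; simp
        have h' : (-1 : K) ^ l * (-1) ^ l = 1 := by rw [← mul_pow]; simp
        linear_combination (-1 : K) ^ l * h - (-1 : K) ^ (s - 1) * h'
      rw [neg_pow, neg_pow ω (s - 1), e4, mul_left_comm, ← pow_add,
        show 2 * l + 1 + (s - 1) = l + n by omega, pow_add, hω1, mul_one]
  have hcoeff : ∀ i < n, P.coeff i * ω ^ i = P.coeff (n - 1 - i) * ω ^ (n - 1 - i) := by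
    intro i hi
    have h := congrArg (fun S : K[X] => S.coeff i) hPQ
    simp only [Q, finsetSum_coeff, coeff_C_mul, coeff_X_pow, mul_ite, mul_one, mul_zero,
      Finset.sum_ite_eq, Finset.mem_range, if_pos hi] at h
    rw [h, mul_assoc, ← pow_add, show 2 * (n - 1 - i) + 1 + i = n - 1 - i + n by omega, pow_add,
      hω1, mul_one]
  have hd : ω * (derivative P).eval ω = ∑ i ∈ Finset.range n, (i : K) * (P.coeff i * ω ^ i) := by
    rw [derivative_eval, sum_over_range' _ _ n hdeg, Finset.mul_sum]
    · refine Finset.sum_congr rfl fun i _ => ?_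
      cases i with
      | zero => simp
      | succ i => rw [Nat.add_sub_cancel, pow_succ]; ring
    · simp
  have hrefl := Finset.sum_range_reflect (fun i => (i : K) * (P.coeff i * ω ^ i)) n
  rw [two_mul]
  nth_rewrite 1 [hd]
  rw [← hrefl, hd, ← Finset.sum_add_distrib, eval_eq_sum_range' hdeg, Finset.mul_sum]
  refine Finset.sum_congr rfl fun i hi => ?_
  have hi := Finset.mem_range.1 hi
  rw [← hcoeff i hi, ← add_mul, ← Nat.cast_add, show n - 1 - i + i = 2 * m by omega]
  push_cast
  ring

/-- With `q = p²` one has `(q;q²)_k = (p;q)_k (-p;q)_k`, which turns the sum into `cauchyPoly` for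
`y = -p` evaluated at `p`. Put `δ = p^(2m+1) - 1`, so `δ² = 0`. Then `p = u^m (1 + δ)` is
infinitesimally near the node `u^m`, where the value is `(-p)^m`. The first-order correction is `m
(-p)^m δ`, and `(-p)^m (1 + mδ) = (-p)^m p^((2m+1)m)`. -/
theorem sum_weightedCentral_dualNumber {K : Type*} [Field K] [CharZero K] {p : DualNumber K}
    {m : ℕ} (hω : IsPrimitiveRoot p.fst (2 * m + 1)) :
    ∑ k ∈ Finset.range (2 * m + 1), (p ^ 2) ^ k *
        Ring.inverse (qShiftedFactorial (-p ^ 2) (p ^ 2) k) * gaussBinom (p ^ 2) (2 * k) k =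
      (-1) ^ m * (p ^ 2) ^ (m * (m + 1)) := by
  have hunit : ∀ x : DualNumber K, x.fst ≠ 0 → IsUnit x := fun x hx =>
    TrivSqZeroExt.isUnit_iff_isUnit_fst.2 (isUnit_iff_ne_zero.2 hx)
  let π : DualNumber K →+* K := TrivSqZeroExt.fstHom K K K
  have hπ : ∀ x, π x = x.fst := fun _ => rfl
  have hp0 : p.fst ≠ 0 := hω.ne_zero (by omega)
  obtain ⟨v, hv⟩ := (hunit p hp0).exists_right_inv
  have hpq : p ^ (2 * m + 1) = 1 + (p ^ (2 * m + 1) - 1) := by ring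
  set δ := p ^ (2 * m + 1) - 1 with hδ_def
  have hδ : δ.fst = 0 := by
    rw [hδ_def, TrivSqZeroExt.fst_sub, TrivSqZeroExt.fst_pow, hω.pow_eq_one,
      TrivSqZeroExt.fst_one, sub_self]
  set q := p ^ 2 with hq
  set u := v ^ 2 with hu
  have huq : u * q = 1 := by rw [hu, hq, ← mul_pow, mul_comm, hv, one_pow]
  have hqfst : q.fst = p.fst ^ 2 := TrivSqZeroExt.fst_pow _ _
  have hζ : IsPrimitiveRoot q.fst (2 * m + 1) := hqfst ▸ hω.pow_of_coprime 2 (by simp)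
  have hufst : u.fst * q.fst = 1 := by rw [← TrivSqZeroExt.fst_mul, huq, TrivSqZeroExt.fst_one]
  have hζ' : IsPrimitiveRoot u.fst (2 * m + 1) := by
    rw [eq_inv_of_mul_eq_one_left hufst]; exact hζ.inv
  have hsf : ∀ {w : DualNumber K}, IsPrimitiveRoot w.fst (2 * m + 1) →
      ∀ k < 2 * m + 1, IsUnit (qShiftedFactorial w w k) := by
    intro w hw k hk
    apply hunit
    rw [← hπ, map_qShiftedFactorial]
    refine Finset.prod_ne_zero_iff.2 fun i hi => ?_
    have := Finset.mem_range.1 hi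
    rw [← pow_succ']
    exact sub_ne_zero.2 (hw.pow_ne_one_of_pos_of_lt (Nat.succ_ne_zero _) (by omega)).symm
  have hneg : ∀ k, IsUnit (qShiftedFactorial (-q) q k) := by
    intro k
    apply hunit
    rw [← hπ, map_qShiftedFactorial, map_neg]
    exact qShiftedFactorial_neg_ne_zero hζ ⟨m, rfl⟩ k
  have hT : ∑ k ∈ Finset.range (2 * m + 1), q ^ k *
      Ring.inverse (qShiftedFactorial (-q) q k) * gaussBinom q (2 * k) k =
      (cauchyPoly u q (-p) (2 * m + 1)).eval p := by
    rw [eval_cauchyPoly]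
    refine Finset.sum_congr rfl fun k hk => ?_
    have hk := Finset.mem_range.1 hk
    have h1 := Ring.inverse_mul_cancel _ (hneg k)
    have h2 := Ring.inverse_mul_cancel _ (hsf hζ' k hk)
    have h3 := gaussBinom_mul_qShiftedFactorial q k k
    rw [← two_mul, qShiftedFactorial_two_mul] at h3
    have hW : ∀ j, qShiftedFactorial q q j =
        (∏ i ∈ Finset.range j, (-q ^ i)) * q ^ j * qShiftedFactorial u u j := by
      intro j
      induction j with
      | zero => simp
      | succ j ih =>
        rw [qShiftedFactorial_succ, ih, qShiftedFactorial_succ, Finset.prod_range_succ]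
        have : u ^ (j + 1) * q ^ (j + 1) = 1 := by rw [← mul_pow, huq, one_pow]
        linear_combination -(∏ i ∈ Finset.range j, (-q ^ i)) * q ^ j *
          qShiftedFactorial u u j * this
    have hW2 : (∏ i ∈ Finset.range k, (-q ^ i)) * ∏ i ∈ Finset.range k, (-p - u ^ i) =
        qShiftedFactorial (-p) q k := by
      unfold qShiftedFactorial
      rw [← Finset.prod_mul_distrib]
      refine Finset.prod_congr rfl fun i _ => ?_
      have : u ^ i * q ^ i = 1 := by rw [← mul_pow, huq, one_pow]
      linear_combination this
    have hpp : qShiftedFactorial p q k * qShiftedFactorial (-p) q k =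
        qShiftedFactorial q (q ^ 2) k := by
      unfold qShiftedFactorial
      rw [← Finset.prod_mul_distrib]
      refine Finset.prod_congr rfl fun i _ => ?_
      rw [hq]; ring
    have hWu : IsUnit (∏ i ∈ Finset.range k, (-q ^ i)) := by
      refine IsUnit.prod_iff.2 fun i _ => ?_
      exact ((IsUnit.of_mul_eq_one_right u (by rw [huq])).pow i).neg
    apply (hneg k).mul_left_cancel
    apply (hsf hζ' k hk).mul_left_cancel
    apply hWu.mul_left_cancel
    apply (hsf hζ k hk).mul_left_cancel
    set W := ∏ i ∈ Finset.range k, (-q ^ i)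
    set Y := ∏ i ∈ Finset.range k, (-p - u ^ i)
    set I := Ring.inverse (qShiftedFactorial (-q) q k)
    set J := Ring.inverse (qShiftedFactorial u u k)
    set U := qShiftedFactorial u u k
    set V := qShiftedFactorial (-q) q k
    set Q := qShiftedFactorial q q k
    have hWk := hW k
    calc Q * (W * (U * (V * (q ^ k * I * gaussBinom q (2 * k) k))))
        = (W * q ^ k * U) * (gaussBinom q (2 * k) k * Q) * (I * V) := by ring
      _ = gaussBinom q (2 * k) k * (Q * Q) := by rw [← hWk, h1]; ring
      _ = qShiftedFactorial p q k * qShiftedFactorial (-p) q k * (Q * V) := by rw [h3, hpp]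
      _ = qShiftedFactorial p q k * (W * Y) * (Q * V) * (J * U) := by rw [hW2, h2, mul_one]
      _ = _ := by ring
  rw [hT]
  have hpv : ∀ i, p ^ i * v ^ i = 1 := fun i => by rw [← mul_pow, hv, one_pow]
  have hsplit : p = u ^ m + u ^ m * δ := by
    have h1 : p = u ^ m * p ^ (2 * m + 1) := by
      rw [hu, ← pow_mul, pow_succ]
      linear_combination -p * hpv (2 * m)
    nth_rewrite 1 [h1, hpq]
    ring
  have hfst0 : (u ^ m * δ).fst = 0 := by rw [TrivSqZeroExt.fst_mul, hδ, mul_zero]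
  have hfu : (u ^ m).fst = p.fst := by
    have := congrArg TrivSqZeroExt.fst hsplit
    rw [TrivSqZeroExt.fst_add, hfst0, add_zero] at this
    exact this.symm
  have hexp := eval_add_of_sq_eq_zero (cauchyPoly u q (-p) (2 * m + 1)) (u ^ m) (u ^ m * δ)
    (DualNumber.sq_eq_zero_of_fst_eq_zero hfst0)
  rw [← hsplit, eval_cauchyPoly_pow huq _ (by omega) (hsf hζ')] at hexp
  set D := cauchyPoly u q (-p) (2 * m + 1)
  have hmap : ∀ (x : DualNumber K) (S : (DualNumber K)[X]), (S.eval x).fst = (S.map π).eval x.fst :=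
    fun x S => by rw [← hπ, ← hπ, eval_map, eval₂_hom]
  have hPm : (D.map π).eval p.fst = (-p.fst) ^ m := by
    have := congrArg TrivSqZeroExt.fst
      (eval_cauchyPoly_pow huq (-p) (show m < 2 * m + 1 by omega) (hsf hζ'))
    rwa [hmap, hfu, TrivSqZeroExt.fst_pow, TrivSqZeroExt.fst_neg] at this
  -- At the level of first components the node `u^(2m+1-s)` is `ω^(2s)`, so the known values are
  -- those required by the interpolation lemma.
  have hder := two_mul_derivative_eval_of_interpolation hω (P := D.map π)
    (natDegree_map_le.trans_lt (natDegree_cauchyPoly_lt u q (-p) (by omega))) (by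
      intro s hs hs'
      have := congrArg TrivSqZeroExt.fst
        (eval_cauchyPoly_pow huq (-p) (show 2 * m + 1 - s < 2 * m + 1 by omega) (hsf hζ'))
      rw [hmap, TrivSqZeroExt.fst_pow u, TrivSqZeroExt.fst_pow (-p), TrivSqZeroExt.fst_neg] at this
      rw [← this]
      congr 1
      have h1 : u.fst ^ s * p.fst ^ (2 * s) = 1 := by
        rw [pow_mul, ← hqfst, ← mul_pow, hufst, one_pow]
      have h2 : u.fst ^ (2 * m + 1 - s) * u.fst ^ s = 1 := by
        rw [← pow_add, Nat.sub_add_cancel hs', hζ'.pow_eq_one]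
      linear_combination p.fst ^ (2 * s) * (-h2) + u.fst ^ (2 * m + 1 - s) * h1)
  have hder' : p.fst * (derivative (D.map π)).eval p.fst = m * (-p.fst) ^ m := by
    rw [hPm] at hder
    apply mul_left_cancel₀ (two_ne_zero : (2 : K) ≠ 0)
    rw [hder]; ring
  -- A product with `δ` depends only on the first component of the other factor, so the derivative
  -- is needed only over the field.
  have hkey : (derivative D).eval (u ^ m) * (u ^ m * δ) = (m * (-p) ^ m) * δ := by
    rw [← mul_assoc]
    apply DualNumber.mul_eq_mul_of_fst_eq _ hδ
    rw [TrivSqZeroExt.fst_mul, hmap, hfu, ← derivative_map, mul_comm, hder']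
    simp
  rw [hexp, hkey, hq, ← pow_mul, show 2 * (m * (m + 1)) = m + (2 * m + 1) * m by ring, pow_add,
    pow_mul p (2 * m + 1), hpq, one_add_pow_of_sq_eq_zero (DualNumber.sq_eq_zero_of_fst_eq_zero hδ),
    neg_pow p m]
  ring

theorem two_mul_triangle (m : ℕ) : 2 * (m * (m + 1) / 2) = m * (m + 1) :=
  Nat.mul_div_cancel' (Nat.even_mul_succ_self m).two_dvd

/-- In effect `ζ^(nk/2) = (-1)^k`: for odd `k` the order `n` must be even, and `ζ^(n/2) = -1`. This
treats both parities of `n` at once. -/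
theorem IsPrimitiveRoot.pow_of_two_mul_eq {K : Type*} [Field K] {ζ : K} {n : ℕ}
    (hζ : IsPrimitiveRoot ζ n) (hn : 0 < n) {a b k : ℕ} (h : 2 * a = 2 * b + n * k) :
    ζ ^ a = (-1) ^ k * ζ ^ b := by
  rcases Nat.even_or_odd' k with ⟨j, rfl | rfl⟩
  · rw [show a = n * j + b by nlinarith, pow_add, pow_mul, hζ.pow_eq_one, one_pow, pow_mul]
    simp
  · obtain ⟨i, rfl⟩ : Even n := by
      have : Even (n * (2 * j + 1)) := by
        rw [Nat.even_iff]; omega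
      rcases Nat.even_mul.1 this with h | h
      · exact h
      · exact absurd h (by simp)
    have hi : ζ ^ i = -1 := by
      have h1 : (ζ ^ i) ^ 2 = 1 := by rw [← pow_mul, mul_two, hζ.pow_eq_one]
      rcases eq_or_eq_neg_of_sq_eq_sq (ζ ^ i) 1 (by rw [h1, one_pow]) with h | h
      · exact absurd h (hζ.pow_ne_one_of_pos_of_lt (by omega) (by omega))
      · exact h
    rw [show a = i * (2 * j + 1) + b by nlinarith, pow_add, pow_mul, hi]

/-! ### Alternating `q`-harmonic sums and the linear parts -/

section HarmonicSums

variable {K : Type*} [Field K]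

/-- The `l`-th term of an alternating `q`-harmonic sum. -/
noncomputable def alternatingTerm (Q : K) (t l : ℕ) : K :=
  (-1) ^ l * Q ^ (l * (l + 1) / 2) * Q⁻¹ ^ (t * l) / (1 - Q ^ l)

theorem alternatingTerm_succ {Q : K} (hQ : Q ≠ 0) (t : ℕ) {l : ℕ} (hl : Q ^ l ≠ 1) :
    alternatingTerm Q (t + 1) l =
      alternatingTerm Q t l + (-1) ^ l * Q ^ (l * (l + 1) / 2) * Q⁻¹ ^ ((t + 1) * l) := by
  have h1 : 1 - Q ^ l ≠ 0 := sub_ne_zero.2 hl.symm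
  have h2 : Q⁻¹ ^ (t * l) = Q⁻¹ ^ ((t + 1) * l) * Q ^ l := by
    rw [add_mul, one_mul, pow_add, mul_assoc, ← mul_pow, inv_mul_cancel₀ hQ, one_pow, mul_one]
  unfold alternatingTerm
  rw [h2]
  field_simp
  ring

/-- With `L = l + 1`, the exponent `L(L+1)/2 - (t+1)L = L(L-2t-1)/2` is unchanged by `L ↦ 2t+1-L`,
while the sign flips. -/
theorem sum_alternating_triangle [CharZero K] {Q : K} (hQ : Q ≠ 0) (t : ℕ) :
    ∑ l ∈ Finset.range (2 * t),
      (-1) ^ (l + 1) * Q ^ ((l + 1) * (l + 1 + 1) / 2) * Q⁻¹ ^ ((t + 1) * (l + 1)) = 0 := by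
  set f : ℕ → K := fun l =>
    (-1) ^ (l + 1) * Q ^ ((l + 1) * (l + 1 + 1) / 2) * Q⁻¹ ^ ((t + 1) * (l + 1)) with hf
  have hrefl : ∀ l ∈ Finset.range (2 * t), f (2 * t - 1 - l) = -f l := by
    intro l hl
    have hl := Finset.mem_range.1 hl
    obtain ⟨j, hj⟩ : ∃ j, 2 * t = l + j + 1 := ⟨2 * t - 1 - l, by omega⟩
    rw [show 2 * t - 1 - l = j by omega]
    have hs : (-1 : K) ^ (j + 1) = -(-1) ^ (l + 1) := by
      have h1 : (-1 : K) ^ (l + 1) * (-1) ^ (j + 1) = -1 := by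
        rw [← pow_add, show l + 1 + (j + 1) = 2 * t + 1 by omega, pow_succ, pow_mul]; simp
      have h2 : (-1 : K) ^ (l + 1) * (-1) ^ (l + 1) = 1 := by rw [← mul_pow]; simp
      linear_combination (-1 : K) ^ (l + 1) * h1 - (-1 : K) ^ (j + 1) * h2
    have e := two_mul_triangle (j + 1)
    have e' := two_mul_triangle (l + 1)
    have he : (j + 1) * (j + 1 + 1) / 2 + (t + 1) * (l + 1) =
        (l + 1) * (l + 1 + 1) / 2 + (t + 1) * (j + 1) := by
      generalize (j + 1) * (j + 1 + 1) / 2 = a at *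
      generalize (l + 1) * (l + 1 + 1) / 2 = b at *
      have : 2 * (a + (t + 1) * (l + 1)) = 2 * (b + (t + 1) * (j + 1)) := by
        zify at e e' hj ⊢
        linear_combination e - e' - (j - l : ℤ) * hj
      omega
    have hinv : ∀ a : ℕ, Q ^ a * Q⁻¹ ^ a = 1 := fun a => by
      rw [← mul_pow, mul_inv_cancel₀ hQ, one_pow]
    have hp : Q ^ ((j + 1) * (j + 1 + 1) / 2) * Q⁻¹ ^ ((t + 1) * (j + 1)) =
        Q ^ ((l + 1) * (l + 1 + 1) / 2) * Q⁻¹ ^ ((t + 1) * (l + 1)) := by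
      have h := congrArg (Q ^ ·) he
      simp only [pow_add] at h
      linear_combination Q⁻¹ ^ ((t + 1) * (j + 1)) * Q⁻¹ ^ ((t + 1) * (l + 1)) * h -
        Q ^ ((j + 1) * (j + 1 + 1) / 2) * Q⁻¹ ^ ((t + 1) * (j + 1)) * hinv ((t + 1) * (l + 1)) +
        Q ^ ((l + 1) * (l + 1 + 1) / 2) * Q⁻¹ ^ ((t + 1) * (l + 1)) * hinv ((t + 1) * (j + 1))
    simp only [hf]
    rw [mul_assoc, hp, hs]; ring
  have h := Finset.sum_range_reflect f (2 * t)
  rw [Finset.sum_congr rfl hrefl, Finset.sum_neg_distrib] at h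
  have : (2 : K) * ∑ l ∈ Finset.range (2 * t), f l = 0 := by linear_combination -h
  exact (mul_eq_zero.1 this).resolve_left two_ne_zero

/-- Raising the parameter from `t` to `t + 1` adds a sum that vanishes by antisymmetry; the new top
term is `-1/(1 - Q^(2t+1))`. -/
theorem sum_alternatingTerm_odd_of_even [CharZero K] {Q : K} (hQ : Q ≠ 0) (t : ℕ)
    (h1 : ∀ l, 1 ≤ l → l ≤ 2 * t + 1 → Q ^ l ≠ 1)
    (ih : ∑ l ∈ Finset.range (2 * t), alternatingTerm Q t (l + 1) =
      -∑ m ∈ Finset.range t, 1 / (1 - Q ^ (t + 1 + m))) :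
    ∑ l ∈ Finset.range (2 * t + 1), alternatingTerm Q (t + 1) (l + 1) =
      -∑ m ∈ Finset.range (t + 1), 1 / (1 - Q ^ (t + 1 + m)) := by
  rw [Finset.sum_range_succ, Finset.sum_range_succ _ t, neg_add, ← ih]
  have : ∀ l ∈ Finset.range (2 * t), alternatingTerm Q (t + 1) (l + 1) =
      alternatingTerm Q t (l + 1) +
        (-1) ^ (l + 1) * Q ^ ((l + 1) * (l + 1 + 1) / 2) * Q⁻¹ ^ ((t + 1) * (l + 1)) := by
    intro l hl
    have := Finset.mem_range.1 hl
    exact alternatingTerm_succ hQ t (h1 _ (by omega) (by omega))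
  rw [Finset.sum_congr rfl this, Finset.sum_add_distrib, sum_alternating_triangle hQ, add_zero]
  congr 1
  unfold alternatingTerm
  rw [show (2 * t + 1) * (2 * t + 1 + 1) / 2 = (t + 1) * (2 * t + 1) by
      rw [show (2 * t + 1) * (2 * t + 1 + 1) = (t + 1) * (2 * t + 1) * 2 by ring,
        Nat.mul_div_cancel _ two_pos],
    mul_assoc, ← mul_pow, mul_inv_cancel₀ hQ, one_pow, pow_succ, pow_mul,
    show t + 1 + t = 2 * t + 1 by ring]
  simp [neg_div]

/-- Each induction step passes through the odd case. The term of index `2t + 2` equals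
`1/(1-Q^(t+1)) - 1/(1-Q^(2t+2))`, which moves the window of denominators one place up. -/
theorem sum_alternatingTerm_even [CharZero K] {Q : K} (hQ : Q ≠ 0) (t : ℕ)
    (h1 : ∀ l, 1 ≤ l → l ≤ 2 * t → Q ^ l ≠ 1) :
    ∑ l ∈ Finset.range (2 * t), alternatingTerm Q t (l + 1) =
      -∑ m ∈ Finset.range t, 1 / (1 - Q ^ (t + 1 + m)) := by
  induction t with
  | zero => simp
  | succ t ih =>
    have h := sum_alternatingTerm_odd_of_even hQ t (fun l hl hl' => h1 l hl (by omega))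
      (ih fun l hl hl' => h1 l hl (by omega))
    rw [show 2 * (t + 1) = 2 * t + 1 + 1 by ring, Finset.sum_range_succ, h,
      Finset.sum_range_succ']
    rw [Finset.sum_range_succ]
    have e : ∀ m, t + 1 + 1 + m = t + 1 + (m + 1) := fun m => by ring
    simp only [e]
    have hlast : alternatingTerm Q (t + 1) (2 * t + 1 + 1) =
        1 / (1 - Q ^ (t + 1)) - 1 / (1 - Q ^ (t + 1 + (t + 1))) := by
      have hne1 : 1 - Q ^ (t + 1) ≠ 0 := sub_ne_zero.2 (h1 _ (by omega) (by omega)).symm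
      have hne2 : 1 - Q ^ (t + 1 + (t + 1)) ≠ 0 := sub_ne_zero.2 (h1 _ (by omega) (by omega)).symm
      unfold alternatingTerm
      rw [show (2 * t + 1 + 1) * (2 * t + 1 + 1 + 1) / 2 = (t + 1) * (2 * t + 1 + 1) + (t + 1) by
          rw [show (2 * t + 1 + 1) * (2 * t + 1 + 1 + 1) =
            ((t + 1) * (2 * t + 1 + 1) + (t + 1)) * 2 by ring, Nat.mul_div_cancel _ two_pos],
        pow_add Q ((t + 1) * (2 * t + 1 + 1)), mul_assoc, mul_right_comm,
        ← mul_pow, mul_inv_cancel₀ hQ, one_pow, show 2 * t + 1 + 1 = t + 1 + (t + 1) by ring]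
      have hs : (-1 : K) ^ (t + 1 + (t + 1)) = 1 := by rw [← two_mul, pow_mul]; simp
      rw [hs]
      field_simp
      ring
    rw [hlast, add_zero]
    ring

theorem sum_alternatingTerm_odd [CharZero K] {Q : K} (hQ : Q ≠ 0) (t : ℕ)
    (h1 : ∀ l, 1 ≤ l → l ≤ 2 * t + 1 → Q ^ l ≠ 1) :
    ∑ l ∈ Finset.range (2 * t + 1), alternatingTerm Q (t + 1) (l + 1) =
      -∑ m ∈ Finset.range (t + 1), 1 / (1 - Q ^ (t + 1 + m)) :=
  sum_alternatingTerm_odd_of_even hQ t h1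
    (sum_alternatingTerm_even hQ t fun l hl hl' => h1 l hl (by omega))

/-- Reversing the range pairs `x` with `1/x`, and `1/(1-x) + 1/(1-1/x) = 1`. -/
theorem two_mul_sum_one_div_one_sub {Q : K} {s t : ℕ} (hQ0 : Q ≠ 0)
    (hQ : Q ^ (2 * s + t) = Q)
    (h1 : ∀ m < t, Q ^ (s + m) ≠ 1) :
    2 * ∑ m ∈ Finset.range t, 1 / (1 - Q ^ (s + m)) = t := by
  have hrefl := Finset.sum_range_reflect (fun m => 1 / (1 - Q ^ (s + m))) t
  rw [two_mul]
  nth_rewrite 1 [← hrefl]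
  rw [← Finset.sum_add_distrib]
  rw [Finset.sum_congr rfl (g := fun _ => (1 : K))]
  · simp
  intro m hm
  have hm := Finset.mem_range.1 hm
  have ha := h1 (t - 1 - m) (by omega)
  have hb := h1 m hm
  have hab : Q ^ (s + (t - 1 - m)) * Q ^ (s + m) = 1 := by
    rw [← pow_add]
    apply mul_right_cancel₀ hQ0
    rw [← pow_succ, show s + (t - 1 - m) + (s + m) + 1 = 2 * s + t by omega, hQ, one_mul]
  have ha' := sub_ne_zero.2 ha.symm
  have hb' := sub_ne_zero.2 hb.symm
  field_simp
  linear_combination -hab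

/-- The terms of index `3m + 1` in the linear part of the central sum. -/
noncomputable def linearTermOne (ζ : K) (m : ℕ) : K :=
  (-1) ^ m * ζ ^ (3 * (m * (m + 1) / 2)) / (1 - ζ ^ (3 * m + 1))

/-- The terms of index `3m + 2` in the linear part of the central sum. -/
noncomputable def linearTermTwo (ζ : K) (m : ℕ) : K :=
  (-1) ^ m * ζ ^ (3 * (m * (m + 1) / 2)) * ζ ^ (3 * m + 2) / (1 - ζ ^ (3 * m + 2))

/-- Reversing `m` in the second family pairs `x = ζ^(3m+1)` with its inverse `y`, and `1/(1-x) +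
y/(1-y) = 0`. -/
theorem sum_linearTerm_three_mul {ζ : K} {t : ℕ} (ht : 0 < t) (hζ : IsPrimitiveRoot ζ (3 * t)) :
    ∑ m ∈ Finset.range t, (linearTermOne ζ m + linearTermTwo ζ m) = 0 := by
  rw [Finset.sum_add_distrib, ← Finset.sum_range_reflect (linearTermTwo ζ),
    ← Finset.sum_add_distrib]
  refine Finset.sum_eq_zero fun m hm => ?_
  have hm := Finset.mem_range.1 hm
  obtain ⟨k, hk⟩ : ∃ k, t = m + k + 1 := ⟨t - 1 - m, by omega⟩
  rw [show t - 1 - m = k by omega]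
  have hxy : ζ ^ (3 * m + 1) * ζ ^ (3 * k + 2) = 1 := by
    rw [← pow_add, show 3 * m + 1 + (3 * k + 2) = 3 * t by omega, hζ.pow_eq_one]
  have hx : 1 - ζ ^ (3 * m + 1) ≠ 0 :=
    sub_ne_zero.2 (hζ.pow_ne_one_of_pos_of_lt (by omega) (by omega)).symm
  have hy : 1 - ζ ^ (3 * k + 2) ≠ 0 :=
    sub_ne_zero.2 (hζ.pow_ne_one_of_pos_of_lt (by omega) (by omega)).symm
  have hsign : (-1 : K) ^ m * ζ ^ (3 * (m * (m + 1) / 2)) =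
      (-1) ^ k * ζ ^ (3 * (k * (k + 1) / 2)) := by
    have e := two_mul_triangle m
    have e' := two_mul_triangle k
    have h := hζ.pow_of_two_mul_eq (by omega) (a := 3 * (m * (m + 1) / 2) + 3 * t * k)
      (b := 3 * (k * (k + 1) / 2)) (k := m + k) (by
        rw [hk]; nlinarith)
    rw [pow_add, pow_mul ζ (3 * t), hζ.pow_eq_one, one_pow, mul_one] at h
    rw [h, ← mul_assoc, ← pow_add, show m + (m + k) = 2 * m + k by ring, pow_add, pow_mul]
    simp
  unfold linearTermOne linearTermTwo
  rw [hsign]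
  field_simp
  linear_combination -((-1) ^ k * ζ ^ (3 * (k * (k + 1) / 2))) * hxy

theorem pow_mul_pow_mul_inv_pow {Q : K} (hQ : Q ≠ 0) {a b c d : ℕ} (h : a + b = c + d) :
    Q ^ a * (Q ^ b * Q⁻¹ ^ c) = Q ^ d := by
  rw [← mul_assoc, ← pow_add, h, pow_add, mul_right_comm, ← mul_pow, mul_inv_cancel₀ hQ, one_pow,
    one_mul]

theorem neg_one_pow_eq_of_even_add {a b : ℕ} (h : Even (a + b)) : (-1 : K) ^ a = (-1) ^ b := by
  rcases Nat.even_or_odd b with hb | hb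
  · rw [hb.neg_one_pow, ((Nat.even_add.1 h).2 hb).neg_one_pow]
  · rw [hb.neg_one_pow, (Nat.not_even_iff_odd.1 fun ha =>
      Nat.not_even_iff_odd.2 hb ((Nat.even_add.1 h).1 ha)).neg_one_pow]

/-- Modulo `3t + 1` one has `-(3m+1) ≡ 3(t-m)` and `3m+2 ≡ 3(t+m+1)`. In terms of `Q = ζ³` the two
families therefore fill the indices `1, …, t` and `t+1, …, 2t` of a single alternating sum. -/
theorem sum_linearTerm_three_mul_add_one [CharZero K] {ζ : K} {t : ℕ}
    (hζ : IsPrimitiveRoot ζ (3 * t + 1)) :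
    2 * ∑ m ∈ Finset.range t, (linearTermOne ζ m + linearTermTwo ζ m) =
      t * ζ ^ (3 * t ^ 2 + 2 * t) := by
  have hQ : IsPrimitiveRoot (ζ ^ 3) (3 * t + 1) := hζ.pow_of_coprime 3 (by simp)
  set Q := ζ ^ 3 with hQdef
  have hQ0 : Q ≠ 0 := hQ.ne_zero (by omega)
  have hne : ∀ l, 1 ≤ l → l ≤ 2 * t → Q ^ l ≠ 1 := fun l hl hl' =>
    hQ.pow_ne_one_of_pos_of_lt (by omega) (by omega)
  have hsum := sum_alternatingTerm_even hQ0 t hne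
  have hhalf := two_mul_sum_one_div_one_sub (s := t + 1) (t := t) hQ0 (by
    rw [show 2 * (t + 1) + t = 3 * t + 1 + 1 by ring, pow_succ, hQ.pow_eq_one, one_mul])
    fun m hm => hne _ (by omega) (by omega)
  have h1 : ∀ m ∈ Finset.range t, linearTermOne ζ m =
      (-1) ^ (t + 1) * Q ^ (t * (t + 1) / 2) * alternatingTerm Q t (t - 1 - m + 1) := by
    intro m hm
    have hm := Finset.mem_range.1 hm
    obtain ⟨l, hl⟩ : ∃ l, t = m + l := ⟨t - m, by omega⟩
    rw [show t - 1 - m + 1 = l by omega]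
    have hx : 1 - ζ ^ (3 * m + 1) ≠ 0 :=
      sub_ne_zero.2 (hζ.pow_ne_one_of_pos_of_lt (by omega) (by omega)).symm
    have hy : 1 - Q ^ l ≠ 0 := sub_ne_zero.2 (hne l (by omega) (by omega)).symm
    have hxy : Q ^ l * ζ ^ (3 * m + 1) = 1 := by
      rw [hQdef, ← pow_mul, ← pow_add, show 3 * l + (3 * m + 1) = 3 * t + 1 by omega,
        hζ.pow_eq_one]
    have hE : Q ^ (t * (t + 1) / 2) * (Q ^ (l * (l + 1) / 2) * Q⁻¹ ^ (t * l)) =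
        Q ^ (m * (m + 1) / 2 + l) := pow_mul_pow_mul_inv_pow hQ0 (by
      have e1 := two_mul_triangle t
      have e2 := two_mul_triangle l
      have e3 := two_mul_triangle m
      rw [hl] at e1 ⊢
      nlinarith)
    have hs : (-1 : K) ^ m = -((-1) ^ (t + 1) * (-1) ^ l) := by
      rw [← pow_add, neg_one_pow_eq_of_even_add (b := t + 1 + l + 1) (by
        rw [hl]; exact ⟨m + l + 1, by ring⟩), pow_succ]
      ring
    unfold linearTermOne alternatingTerm
    rw [show (-1 : K) ^ (t + 1) * Q ^ (t * (t + 1) / 2) *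
      ((-1) ^ l * Q ^ (l * (l + 1) / 2) * Q⁻¹ ^ (t * l) / (1 - Q ^ l)) =
      (-1) ^ (t + 1) * (-1) ^ l *
        (Q ^ (t * (t + 1) / 2) * (Q ^ (l * (l + 1) / 2) * Q⁻¹ ^ (t * l))) / (1 - Q ^ l) by ring,
      hE, hs, pow_mul ζ 3 (m * (m + 1) / 2), ← hQdef, pow_add Q (m * (m + 1) / 2)]
    rw [div_eq_div_iff hx hy]
    linear_combination (-1) ^ (t + 1) * (-1) ^ l * Q ^ (m * (m + 1) / 2) * hxy
  have h2 : ∀ m ∈ Finset.range t, linearTermTwo ζ m =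
      (-1) ^ (t + 1) * Q ^ (t * (t + 1) / 2) * alternatingTerm Q t (t + m + 1) := by
    intro m hm
    have hm := Finset.mem_range.1 hm
    have hxy : Q ^ (t + m + 1) = ζ ^ (3 * m + 2) := by
      rw [hQdef, ← pow_mul, show 3 * (t + m + 1) = 3 * t + 1 + (3 * m + 2) by ring, pow_add,
        hζ.pow_eq_one, one_mul]
    have hE : Q ^ (t * (t + 1) / 2) *
        (Q ^ ((t + m + 1) * (t + m + 1 + 1) / 2) * Q⁻¹ ^ (t * (t + m + 1))) =
        Q ^ (m * (m + 1) / 2 + (t + m + 1)) := pow_mul_pow_mul_inv_pow hQ0 (by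
      have e1 := two_mul_triangle t
      have e2 := two_mul_triangle (t + m + 1)
      have e3 := two_mul_triangle m
      nlinarith)
    have hs : (-1 : K) ^ m = (-1) ^ (t + 1) * (-1) ^ (t + m + 1) := by
      rw [← pow_add, neg_one_pow_eq_of_even_add]
      exact ⟨t + m + 1, by ring⟩
    unfold linearTermTwo alternatingTerm
    rw [show (-1 : K) ^ (t + 1) * Q ^ (t * (t + 1) / 2) *
      ((-1) ^ (t + m + 1) * Q ^ ((t + m + 1) * (t + m + 1 + 1) / 2) * Q⁻¹ ^ (t * (t + m + 1)) /
        (1 - Q ^ (t + m + 1))) =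
      (-1) ^ (t + 1) * (-1) ^ (t + m + 1) * (Q ^ (t * (t + 1) / 2) *
        (Q ^ ((t + m + 1) * (t + m + 1 + 1) / 2) * Q⁻¹ ^ (t * (t + m + 1)))) /
          (1 - Q ^ (t + m + 1)) by ring,
      hE, hs, pow_mul ζ 3 (m * (m + 1) / 2), ← hQdef, pow_add Q (m * (m + 1) / 2), hxy]
    ring
  have hc : ζ ^ (3 * t ^ 2 + 2 * t) = (-1) ^ t * Q ^ (t * (t + 1) / 2) := by
    rw [hQdef, ← pow_mul]
    refine hζ.pow_of_two_mul_eq (by omega) ?_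
    have e1 := two_mul_triangle t
    nlinarith
  have hblock : ∑ m ∈ Finset.range t, (linearTermOne ζ m + linearTermTwo ζ m) =
      (-1) ^ (t + 1) * Q ^ (t * (t + 1) / 2) *
        ∑ l ∈ Finset.range (2 * t), alternatingTerm Q t (l + 1) := by
    rw [Finset.sum_add_distrib, Finset.sum_congr rfl h1, Finset.sum_congr rfl h2,
      ← Finset.mul_sum, ← Finset.mul_sum,
      Finset.sum_range_reflect (fun l => alternatingTerm Q t (l + 1)) t, ← mul_add, two_mul t,
      Finset.sum_range_add _ t t]
  rw [hblock, hsum, hc, pow_succ]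
  linear_combination (-1) ^ t * Q ^ (t * (t + 1) / 2) * hhalf

/-- Modulo `3t + 2` the roles are exchanged: `3m+1 ≡ 3(t+m+1)` and `-(3m+2) ≡ 3(t-m)`. The first
family has one term more, so the indices run to `2t + 1`. -/
theorem sum_linearTerm_three_mul_add_two [CharZero K] {ζ : K} {t : ℕ}
    (hζ : IsPrimitiveRoot ζ (3 * t + 2)) :
    2 * (∑ m ∈ Finset.range t, (linearTermOne ζ m + linearTermTwo ζ m) + linearTermOne ζ t) =
      -(t + 1) * ζ ^ (3 * t ^ 2 + 4 * t + 1) := by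
  have hQ : IsPrimitiveRoot (ζ ^ 3) (3 * t + 2) :=
    hζ.pow_of_coprime 3 ((Nat.Prime.coprime_iff_not_dvd Nat.prime_three).2 (by omega))
  set Q := ζ ^ 3 with hQdef
  have hQ0 : Q ≠ 0 := hQ.ne_zero (by omega)
  have hne : ∀ l, 1 ≤ l → l ≤ 2 * t + 1 → Q ^ l ≠ 1 := fun l hl hl' =>
    hQ.pow_ne_one_of_pos_of_lt (by omega) (by omega)
  have hsum := sum_alternatingTerm_odd hQ0 t hne
  have hhalf := two_mul_sum_one_div_one_sub (s := t + 1) (t := t + 1) hQ0 (by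
    rw [show 2 * (t + 1) + (t + 1) = 3 * t + 2 + 1 by ring, pow_succ, hQ.pow_eq_one, one_mul])
    fun m hm => hne _ (by omega) (by omega)
  have h1 : ∀ m ∈ Finset.range (t + 1), linearTermOne ζ m =
      (-1) ^ (t + 1) * Q ^ (t * (t + 1) / 2) * alternatingTerm Q (t + 1) (t + m + 1) := by
    intro m hm
    have hxy : Q ^ (t + m + 1) = ζ ^ (3 * m + 1) := by
      rw [hQdef, ← pow_mul, show 3 * (t + m + 1) = 3 * t + 2 + (3 * m + 1) by ring, pow_add,
        hζ.pow_eq_one, one_mul]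
    have hE : Q ^ (t * (t + 1) / 2) *
        (Q ^ ((t + m + 1) * (t + m + 1 + 1) / 2) * Q⁻¹ ^ ((t + 1) * (t + m + 1))) =
        Q ^ (m * (m + 1) / 2) := pow_mul_pow_mul_inv_pow hQ0 (by
      have e1 := two_mul_triangle t
      have e2 := two_mul_triangle (t + m + 1)
      have e3 := two_mul_triangle m
      nlinarith)
    have hs : (-1 : K) ^ m = (-1) ^ (t + 1) * (-1) ^ (t + m + 1) := by
      rw [← pow_add, neg_one_pow_eq_of_even_add]
      exact ⟨t + m + 1, by ring⟩
    unfold linearTermOne alternatingTerm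
    rw [show (-1 : K) ^ (t + 1) * Q ^ (t * (t + 1) / 2) *
      ((-1) ^ (t + m + 1) * Q ^ ((t + m + 1) * (t + m + 1 + 1) / 2) *
        Q⁻¹ ^ ((t + 1) * (t + m + 1)) / (1 - Q ^ (t + m + 1))) =
      (-1) ^ (t + 1) * (-1) ^ (t + m + 1) * (Q ^ (t * (t + 1) / 2) *
        (Q ^ ((t + m + 1) * (t + m + 1 + 1) / 2) * Q⁻¹ ^ ((t + 1) * (t + m + 1)))) /
          (1 - Q ^ (t + m + 1)) by ring,
      hE, hs, pow_mul, ← hQdef, hxy]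
  have h2 : ∀ m ∈ Finset.range t, linearTermTwo ζ m =
      (-1) ^ (t + 1) * Q ^ (t * (t + 1) / 2) * alternatingTerm Q (t + 1) (t - 1 - m + 1) := by
    intro m hm
    have hm := Finset.mem_range.1 hm
    obtain ⟨l, hl⟩ : ∃ l, t = m + l := ⟨t - m, by omega⟩
    rw [show t - 1 - m + 1 = l by omega]
    have hx : 1 - ζ ^ (3 * m + 2) ≠ 0 :=
      sub_ne_zero.2 (hζ.pow_ne_one_of_pos_of_lt (by omega) (by omega)).symm
    have hy : 1 - Q ^ l ≠ 0 := sub_ne_zero.2 (hne l (by omega) (by omega)).symm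
    have hxy : Q ^ l * ζ ^ (3 * m + 2) = 1 := by
      rw [hQdef, ← pow_mul, ← pow_add, show 3 * l + (3 * m + 2) = 3 * t + 2 by omega,
        hζ.pow_eq_one]
    have hE : Q ^ (t * (t + 1) / 2) * (Q ^ (l * (l + 1) / 2) * Q⁻¹ ^ ((t + 1) * l)) =
        Q ^ (m * (m + 1) / 2) := pow_mul_pow_mul_inv_pow hQ0 (by
      have e1 := two_mul_triangle t
      have e2 := two_mul_triangle l
      have e3 := two_mul_triangle m
      rw [hl] at e1 ⊢
      nlinarith)
    have hs : (-1 : K) ^ m = -((-1) ^ (t + 1) * (-1) ^ l) := by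
      rw [← pow_add, neg_one_pow_eq_of_even_add (b := t + 1 + l + 1) (by
        rw [hl]; exact ⟨m + l + 1, by ring⟩), pow_succ]
      ring
    unfold linearTermTwo alternatingTerm
    rw [show (-1 : K) ^ (t + 1) * Q ^ (t * (t + 1) / 2) *
      ((-1) ^ l * Q ^ (l * (l + 1) / 2) * Q⁻¹ ^ ((t + 1) * l) / (1 - Q ^ l)) =
      (-1) ^ (t + 1) * (-1) ^ l *
        (Q ^ (t * (t + 1) / 2) * (Q ^ (l * (l + 1) / 2) * Q⁻¹ ^ ((t + 1) * l))) / (1 - Q ^ l) by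
          ring,
      hE, hs, pow_mul ζ 3 (m * (m + 1) / 2), ← hQdef]
    rw [div_eq_div_iff hx hy]
    linear_combination (-1) ^ (t + 1) * (-1) ^ l * Q ^ (m * (m + 1) / 2) * hxy
  have hc : ζ ^ (3 * t ^ 2 + 4 * t + 1) = (-1) ^ (t + 1) * Q ^ (t * (t + 1) / 2) := by
    rw [hQdef, ← pow_mul]
    refine hζ.pow_of_two_mul_eq (by omega) ?_
    have e1 := two_mul_triangle t
    nlinarith
  have hblock : ∑ m ∈ Finset.range t, (linearTermOne ζ m + linearTermTwo ζ m) +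
        linearTermOne ζ t =
      (-1) ^ (t + 1) * Q ^ (t * (t + 1) / 2) *
        ∑ l ∈ Finset.range (2 * t + 1), alternatingTerm Q (t + 1) (l + 1) := by
    rw [Finset.sum_add_distrib, add_right_comm, ← Finset.sum_range_succ, Finset.sum_congr rfl h1,
      Finset.sum_congr rfl h2, ← Finset.mul_sum, ← Finset.mul_sum,
      Finset.sum_range_reflect (fun l => alternatingTerm Q (t + 1) (l + 1)) t, ← mul_add,
      show 2 * t + 1 = t + (t + 1) by ring, Finset.sum_range_add _ t (t + 1),
      add_comm (∑ m ∈ Finset.range (t + 1), _)]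
  rw [hblock, hsum, hc]
  push_cast at hhalf
  linear_combination -(-1) ^ (t + 1) * Q ^ (t * (t + 1) / 2) * hhalf

end HarmonicSums

/-- The Legendre symbol modulo `3` of a natural number. -/
def signModThree (n : ℕ) : ℤ := if n % 3 = 0 then 0 else if n % 3 = 1 then 1 else -1

/-! ### The plain central sum over one period at a dual number -/

section CentralDual

variable {K : Type*} [Field K] {q : DualNumber K} {n : ℕ}

theorem fst_one_sub_pow_order (hζ : IsPrimitiveRoot q.fst n) : (1 - q ^ n).fst = 0 := by
  rw [TrivSqZeroExt.fst_sub, TrivSqZeroExt.fst_pow, hζ.pow_eq_one, TrivSqZeroExt.fst_one, sub_self]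

theorem fst_gaussBinom (q : DualNumber K) (M k : ℕ) :
    (gaussBinom q M k).fst = gaussBinom q.fst M k :=
  map_gaussBinom q (TrivSqZeroExt.fstHom K K K : DualNumber K →+* K) M k

/-- If `c` times the reduction of the Gaussian binomial `[n - 1, j]` is `x (1 - ζ ^ (n - j))`, then
the Gaussian binomial `[2n, n + j]` times `c` is `2x (1 - q ^ n)`. -/
theorem gaussBinom_two_mul_order (hζ : IsPrimitiveRoot q.fst n) {j : ℕ} (h0 : 0 < j) (hj : j < n)
    {c : DualNumber K} {x : K}
    (h : c.fst * gaussBinom q.fst (n - 1) j = x * (1 - q.fst ^ (n - j))) :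
    c * gaussBinom q (2 * n) (n + j) = 2 * TrivSqZeroExt.inl x * (1 - q ^ n) := by
  have hδ := fst_one_sub_pow_order hζ
  have hδ2 := DualNumber.sq_eq_zero_of_fst_eq_zero hδ
  have h1 := gaussBinom_succ_mul_one_sub q (2 * n - 1) (n + j)
  rw [show 2 * n - 1 + 1 = 2 * n by omega, show 2 * n - (n + j) = n - j by omega] at h1
  have h2 : (gaussBinom q (2 * n - 1) (n + j)).fst = gaussBinom q.fst (n - 1) j := by
    have := gaussBinom_lucas hζ 1 1 (b := n - 1) (d := j) (by omega) hj
    rw [fst_gaussBinom, show 2 * n - 1 = 1 * n + (n - 1) by omega, show n + j = 1 * n + j by ring,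
      this]
    simp
  have hunit : IsUnit (1 - q ^ (n - j)) := by
    rw [TrivSqZeroExt.isUnit_iff_isUnit_fst, isUnit_iff_ne_zero, TrivSqZeroExt.fst_sub,
      TrivSqZeroExt.fst_pow, TrivSqZeroExt.fst_one]
    exact sub_ne_zero.2 (hζ.pow_ne_one_of_pos_of_lt (by omega) (by omega)).symm
  have h3 : (c * gaussBinom q (2 * n - 1) (n + j)) * (1 - q ^ n) =
      (TrivSqZeroExt.inl x * (1 - q ^ (n - j))) * (1 - q ^ n) := by
    refine DualNumber.mul_eq_mul_of_fst_eq ?_ hδ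
    rw [TrivSqZeroExt.fst_mul, h2, h]
    simp
  apply hunit.mul_left_cancel
  have h4 : 1 - q ^ (2 * n) = 2 * (1 - q ^ n) := by
    rw [two_mul n, pow_add]; linear_combination -hδ2
  rw [h4] at h1
  linear_combination c * h1 + 2 * h3

theorem gaussBinom_two_mul_order_one (hζ : IsPrimitiveRoot q.fst n) {m : ℕ} (hm : 3 * m + 1 < n) :
    q ^ (6 * m ^ 2 + 3 * m) * gaussBinom q (2 * n) (n + (3 * m + 1)) =
      2 * TrivSqZeroExt.inl (linearTermOne q.fst m) * (1 - q ^ n) := by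
  refine gaussBinom_two_mul_order hζ (by omega) hm ?_
  rw [TrivSqZeroExt.fst_pow]
  set ζ := q.fst
  have hg := gaussBinom_order_sub_one hζ hm
  have hζ0 : ζ ≠ 0 := hζ.ne_zero (by omega)
  have hx : 1 - ζ ^ (3 * m + 1) ≠ 0 :=
    sub_ne_zero.2 (hζ.pow_ne_one_of_pos_of_lt (by omega) hm).symm
  have hinv : ζ ^ (3 * m + 1) * ζ ^ (n - (3 * m + 1)) = 1 := by
    rw [← pow_add, Nat.add_sub_cancel' hm.le, hζ.pow_eq_one]
  have hT : linearTermOne ζ m * (1 - ζ ^ (3 * m + 1)) = (-1) ^ m * ζ ^ (3 * (m * (m + 1) / 2)) :=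
    div_mul_cancel₀ _ hx
  have he : ζ ^ (6 * m ^ 2 + 3 * m) * ζ ^ (3 * m + 1) =
      ζ ^ (3 * (m * (m + 1) / 2)) * ζ ^ ((3 * m + 1) * (3 * m + 1 + 1) / 2) := by
    rw [← pow_add, ← pow_add]
    congr 1
    have e1 := two_mul_triangle m
    have e2 := two_mul_triangle (3 * m + 1)
    nlinarith
  have hs : (-1 : K) ^ (3 * m + 1) = -(-1) ^ m := by
    rw [pow_succ, pow_mul]; norm_num
  apply mul_left_cancel₀ (mul_ne_zero (pow_ne_zero ((3 * m + 1) * (3 * m + 1 + 1) / 2) hζ0)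
    (pow_ne_zero (3 * m + 1) hζ0))
  linear_combination ζ ^ (6 * m ^ 2 + 3 * m) * ζ ^ (3 * m + 1) * (hg + hs) - (-1) ^ m * he +
    ζ ^ ((3 * m + 1) * (3 * m + 1 + 1) / 2) * hT +
    ζ ^ ((3 * m + 1) * (3 * m + 1 + 1) / 2) * linearTermOne ζ m * hinv

theorem gaussBinom_two_mul_order_two (hζ : IsPrimitiveRoot q.fst n) {m : ℕ} (hm : 3 * m + 2 < n) :
    -q ^ (6 * m ^ 2 + 9 * m + 3) * gaussBinom q (2 * n) (n + (3 * m + 2)) =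
      2 * TrivSqZeroExt.inl (linearTermTwo q.fst m) * (1 - q ^ n) := by
  refine gaussBinom_two_mul_order hζ (by omega) hm ?_
  rw [TrivSqZeroExt.fst_neg, TrivSqZeroExt.fst_pow]
  set ζ := q.fst
  have hg := gaussBinom_order_sub_one hζ hm
  have hζ0 : ζ ≠ 0 := hζ.ne_zero (by omega)
  have hx : 1 - ζ ^ (3 * m + 2) ≠ 0 :=
    sub_ne_zero.2 (hζ.pow_ne_one_of_pos_of_lt (by omega) hm).symm
  have hinv : ζ ^ (3 * m + 2) * ζ ^ (n - (3 * m + 2)) = 1 := by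
    rw [← pow_add, Nat.add_sub_cancel' hm.le, hζ.pow_eq_one]
  have hT : linearTermTwo ζ m * (1 - ζ ^ (3 * m + 2)) =
      (-1) ^ m * ζ ^ (3 * (m * (m + 1) / 2)) * ζ ^ (3 * m + 2) :=
    div_mul_cancel₀ _ hx
  have he : ζ ^ (6 * m ^ 2 + 9 * m + 3) * ζ ^ (3 * m + 2) =
      ζ ^ (3 * (m * (m + 1) / 2)) * ζ ^ (3 * m + 2) *
        ζ ^ ((3 * m + 2) * (3 * m + 2 + 1) / 2) := by
    rw [← pow_add, ← pow_add, ← pow_add]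
    congr 1
    have e1 := two_mul_triangle m
    have e2 := two_mul_triangle (3 * m + 2)
    nlinarith
  have hs : (-1 : K) ^ (3 * m + 2) = (-1) ^ m := by
    rw [pow_add, pow_mul]; norm_num
  apply mul_left_cancel₀ (mul_ne_zero (pow_ne_zero ((3 * m + 2) * (3 * m + 2 + 1) / 2) hζ0)
    (pow_ne_zero (3 * m + 2) hζ0))
  linear_combination -ζ ^ (6 * m ^ 2 + 9 * m + 3) * ζ ^ (3 * m + 2) * (hg + hs) - (-1) ^ m * he +
    ζ ^ ((3 * m + 2) * (3 * m + 2 + 1) / 2) * hT +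
    ζ ^ ((3 * m + 2) * (3 * m + 2 + 1) / 2) * linearTermTwo ζ m * hinv

/-- In the finite identity only `[2n, 2n] = 1` is not a multiple of `1 - q^n`, and it occurs exactly
when `3 ∤ n`. Its power of `q` is the claimed one times `q^(nt)` or `q^(n(t+1))`; the resulting
linear correction is cancelled by the sum of the linear terms. -/
theorem sum_central_dualNumber [CharZero K] (hn : 0 < n) (hζ : IsPrimitiveRoot q.fst n) :
    ∑ k ∈ Finset.range n, q ^ k * gaussBinom q (2 * k) k =
      (signModThree n : DualNumber K) * q ^ ((n ^ 2 - 1) / 3) := by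
  have hδ := fst_one_sub_pow_order hζ
  have hδ2 := DualNumber.sq_eq_zero_of_fst_eq_zero hδ
  have hpow : ∀ t : ℕ, q ^ (n * t) = 1 - t * (1 - q ^ n) := by
    intro t
    have := one_add_pow_of_sq_eq_zero (δ := -(1 - q ^ n)) (by rw [neg_sq, hδ2]) t
    rw [pow_mul, show q ^ n = 1 + -(1 - q ^ n) by ring, this]; ring
  obtain ⟨t, ht⟩ : ∃ t, t = n / 3 := ⟨_, rfl⟩
  have htn : t ≤ n := by omega
  rw [sum_pow_mul_gaussBinom_central]
  set F : ℕ → DualNumber K := fun m =>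
    q ^ (6 * m ^ 2 + 3 * m) * gaussBinom q (2 * n) (n + (3 * m + 1)) -
      q ^ (6 * m ^ 2 + 9 * m + 3) * gaussBinom q (2 * n) (n + (3 * m + 2)) with hF
  have hzero : ∀ m, n < 3 * m + 1 → F m = 0 := by
    intro m hm
    simp only [hF]
    rw [gaussBinom_eq_zero_of_lt q (by omega), gaussBinom_eq_zero_of_lt q (by omega)]
    simp
  have htail : ∀ T, T ≤ n → n < 3 * T + 1 →
      ∑ m ∈ Finset.range n, F m = ∑ m ∈ Finset.range T, F m := by
    intro T hT hnT
    symm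
    refine Finset.sum_subset (Finset.range_subset_range.2 hT) fun m _ hm => hzero m ?_
    rw [Finset.mem_range] at hm
    omega
  have hhead : ∀ m, 3 * m + 2 < n → F m =
      2 * TrivSqZeroExt.inl (linearTermOne q.fst m + linearTermTwo q.fst m) * (1 - q ^ n) := by
    intro m hm
    simp only [hF]
    rw [TrivSqZeroExt.inl_add]
    linear_combination gaussBinom_two_mul_order_one hζ (show 3 * m + 1 < n by omega) +
      gaussBinom_two_mul_order_two hζ hm
  have hblock : (∀ m < t, 3 * m + 2 < n) → ∑ m ∈ Finset.range t, F m =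
      TrivSqZeroExt.inl (2 * ∑ m ∈ Finset.range t,
        (linearTermOne q.fst m + linearTermTwo q.fst m)) * (1 - q ^ n) := by
    intro h
    rw [Finset.sum_congr rfl fun m hm => hhead m (h m (Finset.mem_range.1 hm)), ← Finset.sum_mul,
      ← Finset.mul_sum, TrivSqZeroExt.inl_mul, TrivSqZeroExt.inl_sum]
    rfl
  have h012 : n % 3 = 0 ∨ n % 3 = 1 ∨ n % 3 = 2 := by omega
  rcases h012 with h | h | h
  · obtain rfl : n = 3 * t := by omega
    rw [htail t htn (by omega), hblock fun m hm => by omega,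
      sum_linearTerm_three_mul (by omega) hζ]
    simp [signModThree]
  · obtain rfl : n = 3 * t + 1 := by omega
    have hlast : F t = q ^ (6 * t ^ 2 + 3 * t) := by
      simp only [hF]
      rw [gaussBinom_eq_zero_of_lt q (show 2 * (3 * t + 1) < 3 * t + 1 + (3 * t + 2) by omega),
        ← two_mul, gaussBinom_self]
      ring
    rw [htail (t + 1) (by omega) (by omega), Finset.sum_range_succ, hlast,
      hblock fun m hm => by omega, sum_linearTerm_three_mul_add_one hζ,
      show ((3 * t + 1) ^ 2 - 1) / 3 = 3 * t ^ 2 + 2 * t by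
        rw [show (3 * t + 1) ^ 2 = (3 * t ^ 2 + 2 * t) * 3 + 1 by ring, Nat.add_sub_cancel,
          Nat.mul_div_cancel _ (by norm_num)],
      show 6 * t ^ 2 + 3 * t = 3 * t ^ 2 + 2 * t + (3 * t + 1) * t by ring,
      pow_add q (3 * t ^ 2 + 2 * t), hpow]
    have hinl : TrivSqZeroExt.inl ((t : K) * q.fst ^ (3 * t ^ 2 + 2 * t)) * (1 - q ^ (3 * t + 1)) =
        ((t : DualNumber K) * q ^ (3 * t ^ 2 + 2 * t)) * (1 - q ^ (3 * t + 1)) :=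
      DualNumber.mul_eq_mul_of_fst_eq (by simp) hδ
    have hsign : signModThree (3 * t + 1) = 1 := by
      unfold signModThree; rw [if_neg (by omega), if_pos (by omega)]
    rw [hinl, hsign]
    push_cast
    ring
  · obtain rfl : n = 3 * t + 2 := by omega
    have hlast : F t = 2 * TrivSqZeroExt.inl (linearTermOne q.fst t) * (1 - q ^ (3 * t + 2)) -
        q ^ (6 * t ^ 2 + 9 * t + 3) := by
      rw [← gaussBinom_two_mul_order_one hζ (by omega)]
      simp only [hF]
      rw [← two_mul (3 * t + 2), gaussBinom_self, mul_one]
    have hinl : TrivSqZeroExt.inl (-((t : K) + 1) * q.fst ^ (3 * t ^ 2 + 4 * t + 1)) *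
        (1 - q ^ (3 * t + 2)) =
        (-((t : DualNumber K) + 1) * q ^ (3 * t ^ 2 + 4 * t + 1)) * (1 - q ^ (3 * t + 2)) :=
      DualNumber.mul_eq_mul_of_fst_eq (by simp) hδ
    have hsign : signModThree (3 * t + 2) = -1 := by
      unfold signModThree; rw [if_neg (by omega), if_neg (by omega)]
    have hsum := sum_linearTerm_three_mul_add_two hζ
    have hcomb : TrivSqZeroExt.inl (2 * ∑ m ∈ Finset.range t,
          (linearTermOne q.fst m + linearTermTwo q.fst m)) * (1 - q ^ (3 * t + 2)) +
        2 * TrivSqZeroExt.inl (linearTermOne q.fst t) * (1 - q ^ (3 * t + 2)) =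
        (-((t : DualNumber K) + 1) * q ^ (3 * t ^ 2 + 4 * t + 1)) * (1 - q ^ (3 * t + 2)) := by
      rw [← hinl, ← hsum, mul_add, TrivSqZeroExt.inl_add, TrivSqZeroExt.inl_mul _ 2
        (linearTermOne q.fst t), add_mul]
      rfl
    rw [htail (t + 1) (by omega) (by omega), Finset.sum_range_succ, hlast,
      hblock fun m hm => by omega, ← add_sub_assoc, hcomb, hsign,
      show ((3 * t + 2) ^ 2 - 1) / 3 = 3 * t ^ 2 + 4 * t + 1 by
        rw [show (3 * t + 2) ^ 2 = (3 * t ^ 2 + 4 * t + 1) * 3 + 1 by ring, Nat.add_sub_cancel,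
          Nat.mul_div_cancel _ (by norm_num)],
      show 6 * t ^ 2 + 9 * t + 3 = 3 * t ^ 2 + 4 * t + 1 + (3 * t + 2) * (t + 1) by ring,
      pow_add q (3 * t ^ 2 + 4 * t + 1), hpow]
    push_cast
    ring

end CentralDual

/-! ### The Kronecker symbol of `-3` -/

theorem signModThree_mul (a b : ℕ) :
    signModThree (a * b) = signModThree a * signModThree b := by
  unfold signModThree
  rw [Nat.mul_mod]
  have ha : a % 3 < 3 := Nat.mod_lt _ (by norm_num)
  have hb : b % 3 < 3 := Nat.mod_lt _ (by norm_num)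
  generalize a % 3 = x at *
  generalize b % 3 = y at *
  interval_cases x <;> interval_cases y <;> rfl

theorem signModThree_eq_zero {n : ℕ} (h : 3 ∣ n) : signModThree n = 0 :=
  if_pos (Nat.mod_eq_zero_of_dvd h)

/-- On odd numbers the Jacobi symbol has period `12`, so finitely many residues suffice; at `2` both
sides give `-1`, and multiplicativity does the rest. -/
theorem kroneckerSymbol_neg_three {n : ℕ} (hn : n ≠ 0) :
    kroneckerSymbol (-3) n = signModThree n := by
  have hodd : ∀ m : ℕ, ¬ 2 ∣ m → jacobiSym (-3) m = signModThree m := by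
    intro m hm
    have hm1 : m % 2 = 1 := by omega
    have hJ := jacobiSym.mod_right (-3) (Nat.odd_iff.2 hm1)
    have hsgn : signModThree m = signModThree (m % 12) := by
      unfold signModThree
      rw [Nat.mod_mod_of_dvd _ (by norm_num)]
    rw [hJ, hsgn]
    have h12 : m % 12 < 12 := Nat.mod_lt _ (by norm_num)
    have h2 : m % 12 % 2 = 1 := by omega
    rw [show 4 * (-3 : ℤ).natAbs = 12 from rfl]
    generalize m % 12 = x at *
    interval_cases x <;> first | omega | (norm_num [signModThree])
  have hχ : ZMod.χ₈ ((-3 : ℤ) : ZMod 8) = -1 := by decide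
  obtain ⟨v, hv⟩ : ∃ v, v = padicValNat 2 n := ⟨_, rfl⟩
  have hdvd : 2 ^ v ∣ n := hv ▸ pow_padicValNat_dvd
  obtain ⟨m, hm⟩ := hdvd
  have hm2 : ¬ 2 ∣ m := by
    rintro ⟨l, rfl⟩
    have : 2 ^ (padicValNat 2 n + 1) ∣ n := ⟨l, by rw [← hv, hm]; ring⟩
    exact pow_succ_padicValNat_not_dvd hn this
  unfold kroneckerSymbol
  rw [if_neg hn, hχ, ← hv]
  rw [show n / 2 ^ v = m by rw [hm, Nat.mul_div_cancel_left _ (by positivity)], hodd m hm2, hm,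
    signModThree_mul]
  congr 1
  clear hv hm
  induction v with
  | zero => rfl
  | succ v ih => rw [pow_succ, pow_succ, signModThree_mul, ← ih]; rfl

theorem fst_inverse {K : Type*} [Field K] {x : DualNumber K} (hx : IsUnit x) :
    (Ring.inverse x).fst = Ring.inverse x.fst := by
  rw [Ring.inverse_eq_inv']
  refine eq_inv_of_mul_eq_one_left ?_
  rw [← TrivSqZeroExt.fst_mul, Ring.inverse_mul_cancel _ hx, TrivSqZeroExt.fst_one]

/-! ### One-period values at ordinary roots of unity -/

section Values

variable {K : Type*} [Field K] {N : ℕ}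

theorem isUnit_qShiftedFactorial_neg [CharZero K] {q : DualNumber K} (hζ : IsPrimitiveRoot q.fst N)
    (hN : Odd N) (k : ℕ) : IsUnit (qShiftedFactorial (-q) q k) := by
  rw [TrivSqZeroExt.isUnit_iff_isUnit_fst, isUnit_iff_ne_zero]
  have := map_qShiftedFactorial q (TrivSqZeroExt.fstHom K K K : DualNumber K →+* K) (-q) k
  rw [map_neg] at this
  exact fun h => qShiftedFactorial_neg_ne_zero hζ hN k (this.symm.trans h)

theorem sum_central_value [CharZero K] {ζ : K} (hN : 0 < N) (hζ : IsPrimitiveRoot ζ N) :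
    ∑ k ∈ Finset.range N, ζ ^ k * gaussBinom ζ (2 * k) k =
      (signModThree N : K) * ζ ^ ((N ^ 2 - 1) / 3) := by
  have h := congrArg (TrivSqZeroExt.fstHom K K K : DualNumber K →+* K)
    (sum_central_dualNumber (q := TrivSqZeroExt.inl ζ) hN hζ)
  simpa only [map_sum, map_mul, map_pow, map_gaussBinom, map_intCast, RingHom.coe_coe,
    TrivSqZeroExt.fstHom_apply, TrivSqZeroExt.fst_inl] using h

theorem sum_weightedCentral_dualNumber_value [CharZero K] {p : DualNumber K} (hN : Odd N)
    (hω : IsPrimitiveRoot p.fst N) :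
    ∑ k ∈ Finset.range N, (p ^ 2) ^ k *
        Ring.inverse (qShiftedFactorial (-p ^ 2) (p ^ 2) k) * gaussBinom (p ^ 2) (2 * k) k =
      (-1) ^ ((N - 1) / 2) * (p ^ 2) ^ ((N ^ 2 - 1) / 4) := by
  obtain ⟨m, rfl⟩ := hN
  rw [sum_weightedCentral_dualNumber hω, Nat.add_sub_cancel, Nat.mul_div_cancel_left _ two_pos,
    show (2 * m + 1) ^ 2 - 1 = m * (m + 1) * 4 by
      rw [show (2 * m + 1) ^ 2 = m * (m + 1) * 4 + 1 by ring, Nat.add_sub_cancel],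
    Nat.mul_div_cancel _ (by norm_num)]

theorem IsPrimitiveRoot.exists_sq_eq_of_odd {ζ : K} (hζ : IsPrimitiveRoot ζ N) (hN : Odd N) :
    ∃ ω, IsPrimitiveRoot ω N ∧ ω ^ 2 = ζ := by
  obtain ⟨m, rfl⟩ := hN
  refine ⟨ζ ^ (m + 1), hζ.pow_of_coprime _ ?_, ?_⟩
  · have : Nat.Coprime (m + 1) (m + 1 + m) := by simp
    rwa [show 2 * m + 1 = m + 1 + m by ring]
  · rw [← pow_mul, show (m + 1) * 2 = 2 * m + 1 + 1 by ring, pow_succ, hζ.pow_eq_one, one_mul]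

theorem sum_weightedCentral_value [CharZero K] {ζ : K} (hN : Odd N) (hζ : IsPrimitiveRoot ζ N) :
    ∑ k ∈ Finset.range N,
        ζ ^ k * Ring.inverse (qShiftedFactorial (-ζ) ζ k) * gaussBinom ζ (2 * k) k =
      (-1) ^ ((N - 1) / 2) * ζ ^ ((N ^ 2 - 1) / 4) := by
  obtain ⟨ω, hω, rfl⟩ := hζ.exists_sq_eq_of_odd hN
  set p : DualNumber K := TrivSqZeroExt.inl ω with hp
  have hfst : (p ^ 2).fst = ω ^ 2 := by rw [TrivSqZeroExt.fst_pow]; rfl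
  have h := congrArg (TrivSqZeroExt.fstHom K K K : DualNumber K →+* K)
    (sum_weightedCentral_dualNumber_value (p := p) hN hω)
  have hinv : ∀ k, (Ring.inverse (qShiftedFactorial (-p ^ 2) (p ^ 2) k)).fst =
      Ring.inverse (qShiftedFactorial (-ω ^ 2) (ω ^ 2) k) := by
    intro k
    rw [fst_inverse (isUnit_qShiftedFactorial_neg (N := N) (by rwa [hfst]) hN k), ← hfst]
    congr 1
    exact map_qShiftedFactorial (p ^ 2) (TrivSqZeroExt.fstHom K K K : DualNumber K →+* K) _ k
  simp only [map_sum, map_mul, map_pow, map_gaussBinom, map_neg, map_one, RingHom.coe_coe,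
    TrivSqZeroExt.fstHom_apply, hinv] at h
  simpa only [hp, TrivSqZeroExt.fst_inl] using h

end Values

/-! ### Arithmetic of the exponents -/

section Exponents

variable {n c : ℕ}

theorem mul_pow_sq_sub_one_div (h : n ^ 2 ≡ 1 [MOD c]) (j : ℕ) :
    c * (((n ^ j) ^ 2 - 1) / c) = (n ^ j) ^ 2 - 1 := by
  refine Nat.mul_div_cancel' ?_
  rcases Nat.eq_zero_or_pos ((n ^ j) ^ 2) with h0 | h0
  · simp [h0]
  · have := h.pow j
    rw [one_pow, ← pow_mul, mul_comm, pow_mul] at this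
    exact (Nat.modEq_iff_dvd' h0).1 this.symm

theorem mul_sub_one_mul_div (hn : 0 < n) (h : n ^ 2 ≡ 1 [MOD c]) (s : ℕ) :
    c * ((n - 1) * (1 + n ^ (2 * s + 1)) / c) = (n - 1) * (1 + n ^ (2 * s + 1)) := by
  refine Nat.mul_div_cancel' ((Nat.modEq_zero_iff_dvd).1 ?_)
  have h1 : n ^ (2 * s + 1) ≡ n [MOD c] := by
    have := (h.pow s).mul_right n
    rwa [one_pow, one_mul, ← pow_mul, ← pow_succ] at this
  refine ((h1.add_left 1).mul_left (n - 1)).trans ?_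
  have h2 : (n - 1) * (1 + n) = n ^ 2 - 1 := by
    obtain ⟨k, rfl⟩ : ∃ k, n = k + 1 := ⟨n - 1, by omega⟩
    rw [Nat.add_sub_cancel, show (k + 1) ^ 2 = k * (1 + (k + 1)) + 1 by ring, Nat.add_sub_cancel]
  rw [h2]
  exact (Nat.modEq_zero_iff_dvd).2 ((Nat.modEq_iff_dvd' (Nat.pow_pos hn)).1 h.symm)

theorem dwork_exponent_eq (hn : 0 < n) (hc : 0 < c) (h : n ^ 2 ≡ 1 [MOD c]) (s : ℕ) :
    (n - 1) * (1 + n ^ (2 * s + 1)) / c + n * (((n ^ s) ^ 2 - 1) / c) =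
      ((n ^ (s + 1)) ^ 2 - 1) / c := by
  apply Nat.eq_of_mul_eq_mul_left hc
  have h1 := mul_sub_one_mul_div hn h s
  have h2 := mul_pow_sq_sub_one_div h s
  have h3 := mul_pow_sq_sub_one_div h (s + 1)
  have p1 : 1 ≤ (n ^ s) ^ 2 := Nat.pow_pos (Nat.pow_pos hn)
  have p2 : 1 ≤ (n ^ (s + 1)) ^ 2 := Nat.pow_pos (Nat.pow_pos hn)
  rw [h3, mul_add, h1, mul_left_comm, h2]
  zify [p1, p2, show 1 ≤ n from hn]
  ring

/-- Replacing `s` by `j ≤ s` changes the numerator by a multiple of `n^(j+1)`, and division by `c`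
preserves this because `c` is prime to `n`. The exact identity at level `j` then applies. -/
theorem dwork_exponent_modEq (hn : 0 < n) (hc : 0 < c) (h : n ^ 2 ≡ 1 [MOD c])
    (hcop : Nat.Coprime c n) {s j : ℕ} (hj : j ≤ s) :
    (n - 1) * (1 + n ^ (2 * s + 1)) / c + n * (((n ^ j) ^ 2 - 1) / c) ≡
      ((n ^ (j + 1)) ^ 2 - 1) / c [MOD n ^ (j + 1)] := by
  rw [← dwork_exponent_eq hn hc h j]
  refine Nat.ModEq.add_right _ ?_
  refine Nat.ModEq.cancel_left_of_coprime (c := c) ?_ ?_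
  · exact (hcop.symm.pow_left _)
  · rw [mul_sub_one_mul_div hn h, mul_sub_one_mul_div hn h]
    refine Nat.ModEq.mul_left _ (Nat.ModEq.add_left _ ?_)
    have : ∀ i, j ≤ i → n ^ (2 * i + 1) ≡ 0 [MOD n ^ (j + 1)] := fun i hi =>
      (Nat.modEq_zero_iff_dvd).2 (pow_dvd_pow n (by omega))
    exact (this s hj).trans (this j le_rfl).symm

end Exponents

/-! ### Assembly of the congruences -/

theorem ratFuncCongr_dworkModulus {n r d : ℕ} (hn : 1 < n) (hr : 1 ≤ r) (hd : d = 1 ∨ d = 2)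
    {A B : RatFunc ℤ}
    (h : ∀ j, 1 ≤ j → j ≤ r → ∀ ζ : ℂ, IsPrimitiveRoot ζ (n ^ j) →
      ∃ a, EvaluatesTo ζ A a ∧ EvaluatesTo ζ B a)
    (h2 : d = 1 → ∃ q : DualNumber ℂ, IsPrimitiveRoot q.fst (n ^ r) ∧ q.snd ≠ 0 ∧
      ∃ a, EvaluatesTo q A a ∧ EvaluatesTo q B a) :
    RatFuncCongr (dworkModulus n r d) A B := by
  have hpos : ∀ j, 0 < n ^ j := fun j => Nat.pow_pos (by omega)
  refine dworkModulus_dvd hn hr hd (fun j hj hjr => ?_) fun hd1 => ?_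
  · have hζ := Complex.isPrimitiveRoot_exp (n ^ j) (hpos j).ne'
    obtain ⟨a, hA, hB⟩ := h j hj hjr _ hζ
    have := hA.sub hB
    rw [sub_self] at this
    exact cyclotomic_dvd_of_aeval_eq_zero (hpos j) hζ this.aeval_num_eq_zero
  · obtain ⟨q, hζ, hq, a, hA, hB⟩ := h2 hd1
    have := hA.sub hB
    rw [sub_self] at this
    exact cyclotomic_sq_dvd_of_aeval_eq_zero (hpos r) hζ hq this.aeval_num_eq_zero

theorem centralSum_congr {n s d : ℕ} (hn : 1 < n) (hd : d = 1 ∨ d = 2 ∧ Odd n) :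
    RatFuncCongr (dworkModulus n (s + 1) d)
      (centralSum RatFunc.X ((n ^ (s + 1) - 1) / d))
      (RatFunc.X ^ ((n - 1) * (1 + n ^ (2 * s + 1)) / 3) * ((signModThree n : ℤ) : RatFunc ℤ) *
        centralSum (RatFunc.X ^ n) ((n ^ s - 1) / d)) := by
  have hn0 : 0 < n := by omega
  have hpos : ∀ j, 0 < n ^ j := fun j => Nat.pow_pos hn0
  have hmod : ¬ 3 ∣ n → n ^ 2 ≡ 1 [MOD 3] := by
    intro h
    rw [Nat.ModEq, Nat.pow_mod]
    have : n % 3 = 1 ∨ n % 3 = 2 := by omega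
    rcases this with h | h <;> rw [h]
  refine ratFuncCongr_dworkModulus hn (by omega) (hd.imp_right And.left) ?_ ?_
  · intro j hj hjs ζ hζ
    obtain ⟨j, rfl⟩ : ∃ i, j = i + 1 := ⟨j - 1, by omega⟩
    have hX := EvaluatesTo.X ζ
    have hA := evaluatesTo_centralSum ζ one_pos ((n ^ (s + 1) - 1) / d)
    have hB := ((hX.pow ((n - 1) * (1 + n ^ (2 * s + 1)) / 3)).mul
      (EvaluatesTo.intCast ζ (signModThree n))).mul
        (evaluatesTo_centralSum ζ hn0 ((n ^ s - 1) / d))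
    rw [pow_one, pow_one] at hA
    refine ⟨_, hA, ?_⟩
    convert hB using 1
    have hζn : IsPrimitiveRoot (ζ ^ n) (n ^ j) := hζ.pow (hpos _) (pow_succ' n j)
    have hd' : ∀ i, d = 1 ∨ d = 2 ∧ Odd (n ^ (s - j)) ∧ Odd (n ^ i) := fun i =>
      hd.imp_right fun h => ⟨h.1, h.2.pow, h.2.pow⟩
    -- Both sides split into `n^(s-j)` blocks, of length `n^(j+1)` for `ζ` and `n^j` for `ζ^n`, so
    -- the ordinary central binomial sums coincide.
    rw [show n ^ (s + 1) = n ^ (s - j) * n ^ (j + 1) by rw [← pow_add]; congr 1; omega,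
      sum_central_primitiveRoot hζ (hpos _) (hpos _) (hd' _), sum_central_value (hpos _) hζ,
      show n ^ s = n ^ (s - j) * n ^ j by rw [← pow_add]; congr 1; omega,
      sum_central_primitiveRoot hζn (hpos _) (hpos _) (hd' _), sum_central_value (hpos _) hζn,
      pow_succ' n j, signModThree_mul]
    -- If `3 ∣ n` the division in the exponent is not exact, but both sides are zero.
    by_cases h3 : 3 ∣ n
    · rw [signModThree_eq_zero h3]; simp
    · have he := pow_eq_pow_of_modEq (dwork_exponent_modEq hn0 (by norm_num) (hmod h3)
        ((Nat.Prime.coprime_iff_not_dvd Nat.prime_three).2 h3) (show j ≤ s by omega))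
        hζ.pow_eq_one
      rw [pow_add, pow_mul] at he
      rw [← pow_succ' n j, ← he]
      push_cast
      ring
  · rintro rfl
    have hζ := Complex.isPrimitiveRoot_exp (n ^ (s + 1)) (hpos _).ne'
    refine ⟨TrivSqZeroExt.inl _ + DualNumber.eps, by simpa using hζ, by simp, ?_⟩
    set q : DualNumber ℂ := TrivSqZeroExt.inl _ + DualNumber.eps with hq
    replace hζ : IsPrimitiveRoot q.fst (n ^ (s + 1)) := by simpa [hq] using hζ
    have hX := EvaluatesTo.X q
    have hA := evaluatesTo_centralSum q one_pos ((n ^ (s + 1) - 1) / 1)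
    have hB := ((hX.pow ((n - 1) * (1 + n ^ (2 * s + 1)) / 3)).mul
      (EvaluatesTo.intCast q (signModThree n))).mul
        (evaluatesTo_centralSum q hn0 ((n ^ s - 1) / 1))
    rw [pow_one, pow_one] at hA
    refine ⟨_, hA, ?_⟩
    convert hB using 1
    have hζn : IsPrimitiveRoot (q ^ n).fst (n ^ s) := by
      rw [TrivSqZeroExt.fst_pow]; exact hζ.pow (hpos _) (pow_succ' n s)
    rw [Nat.div_one, Nat.div_one, Nat.sub_add_cancel (hpos _), Nat.sub_add_cancel (hpos _),
      sum_central_dualNumber (hpos _) hζ, sum_central_dualNumber (hpos _) hζn]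
    by_cases h3 : 3 ∣ n
    · rw [pow_succ' n s, signModThree_mul, signModThree_eq_zero h3]; simp
    · rw [← dwork_exponent_eq hn0 (by norm_num) (hmod h3),
        pow_add q ((n - 1) * (1 + n ^ (2 * s + 1)) / 3), pow_mul q n, pow_succ' n s,
        signModThree_mul]
      push_cast
      ring

theorem neg_one_pow_half_mul {R : Type*} [CommRing R] {a b : ℕ} (ha : Odd a) (hb : Odd b) :
    (-1 : R) ^ ((a * b - 1) / 2) = (-1) ^ ((a - 1) / 2) * (-1) ^ ((b - 1) / 2) := by
  obtain ⟨x, rfl⟩ := ha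
  obtain ⟨y, rfl⟩ := hb
  rw [show (2 * x + 1) * (2 * y + 1) = 2 * (2 * (x * y) + (x + y)) + 1 by ring]
  simp only [Nat.add_sub_cancel, Nat.mul_div_cancel_left _ two_pos]
  rw [pow_add, pow_mul, pow_add]
  simp

theorem weightedCentralSum_congr {n s d : ℕ} (hn : 1 < n) (hodd : Odd n) (hd : d = 1 ∨ d = 2) :
    RatFuncCongr (dworkModulus n (s + 1) d)
      (weightedCentralSum RatFunc.X ((n ^ (s + 1) - 1) / d))
      ((-1) ^ ((n - 1) / 2) * RatFunc.X ^ ((n - 1) * (1 + n ^ (2 * s + 1)) / 4) *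
        weightedCentralSum (RatFunc.X ^ n) ((n ^ s - 1) / d)) := by
  have hn0 : 0 < n := by omega
  have hpos : ∀ j, 0 < n ^ j := fun j => Nat.pow_pos hn0
  have hmod : n ^ 2 ≡ 1 [MOD 4] := by
    rw [Nat.ModEq, Nat.pow_mod]
    have := Nat.odd_iff.1 hodd
    have : n % 4 = 1 ∨ n % 4 = 3 := by omega
    rcases this with h | h <;> rw [h]
  refine ratFuncCongr_dworkModulus hn (by omega) hd ?_ ?_
  · intro j hj hjs ζ hζ
    obtain ⟨j, rfl⟩ : ∃ i, j = i + 1 := ⟨j - 1, by omega⟩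
    have hX := EvaluatesTo.X ζ
    have hζn : IsPrimitiveRoot (ζ ^ n) (n ^ j) := hζ.pow (hpos _) (pow_succ' n j)
    have hA := evaluatesTo_weightedCentralSum ζ one_pos (fun k => by
      rw [pow_one]
      exact isUnit_iff_ne_zero.2 (qShiftedFactorial_neg_ne_zero hζ hodd.pow k))
      ((n ^ (s + 1) - 1) / d)
    have hB := (((EvaluatesTo.one ζ).neg.pow ((n - 1) / 2)).mul
      (hX.pow ((n - 1) * (1 + n ^ (2 * s + 1)) / 4))).mul
        (evaluatesTo_weightedCentralSum ζ hn0 (fun k =>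
          isUnit_iff_ne_zero.2 (qShiftedFactorial_neg_ne_zero hζn hodd.pow k))
          ((n ^ s - 1) / d))
    rw [pow_one, pow_one] at hA
    refine ⟨_, hA, ?_⟩
    convert hB using 1
    have hd' : ∀ i, d = 1 ∨ d = 2 ∧ Odd (n ^ (s - j)) ∧ Odd (n ^ i) := fun i =>
      hd.imp_right fun h => ⟨h, hodd.pow, hodd.pow⟩
    rw [show n ^ (s + 1) = n ^ (s - j) * n ^ (j + 1) by rw [← pow_add]; congr 1; omega,
      sum_weightedCentral_primitiveRoot hζ (hpos _) hodd.pow (hd' _),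
      sum_weightedCentral_value hodd.pow hζ,
      show n ^ s = n ^ (s - j) * n ^ j by rw [← pow_add]; congr 1; omega,
      sum_weightedCentral_primitiveRoot hζn (hpos _) hodd.pow (hd' _),
      sum_weightedCentral_value hodd.pow hζn]
    have he := pow_eq_pow_of_modEq (dwork_exponent_modEq hn0 (by norm_num) hmod
      ((Nat.coprime_two_left.2 hodd).pow_left 2) (show j ≤ s by omega)) hζ.pow_eq_one
    rw [pow_add, pow_mul] at he
    rw [← he, pow_succ' n j, neg_one_pow_half_mul hodd hodd.pow]
    ring
  · rintro rfl
    obtain ⟨p, hp, hp'⟩ : ∃ p : DualNumber ℂ, IsPrimitiveRoot p.fst (n ^ (s + 1)) ∧ p.snd ≠ 0 :=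
      ⟨TrivSqZeroExt.inl _ + DualNumber.eps,
        by simpa using Complex.isPrimitiveRoot_exp (n ^ (s + 1)) (hpos _).ne', by simp⟩
    have hp0 : p.fst ≠ 0 := hp.ne_zero (hpos _).ne'
    have hζ : IsPrimitiveRoot (p ^ 2).fst (n ^ (s + 1)) := by
      rw [TrivSqZeroExt.fst_pow]
      exact hp.pow_of_coprime 2 (Nat.coprime_two_left.2 hodd.pow)
    have hpn : IsPrimitiveRoot (p ^ n).fst (n ^ s) := by
      rw [TrivSqZeroExt.fst_pow]; exact hp.pow (hpos _) (pow_succ' n s)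
    have hζn : IsPrimitiveRoot ((p ^ 2) ^ n).fst (n ^ s) := by
      rw [TrivSqZeroExt.fst_pow]; exact hζ.pow (hpos _) (pow_succ' n s)
    -- The closed form needs a square root of the evaluation point, so the point is chosen as a
    -- square; its `ε`-part is twice the product of the two components of `p`, hence nonzero.
    refine ⟨p ^ 2, hζ, ?_, ?_⟩
    · rw [sq, DualNumber.snd_mul, mul_comm p.snd, ← two_mul]
      exact mul_ne_zero two_ne_zero (mul_ne_zero hp0 hp')
    have hX := EvaluatesTo.X (p ^ 2)
    have hA := evaluatesTo_weightedCentralSum (p ^ 2) one_pos (fun k => by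
      rw [pow_one]
      exact isUnit_qShiftedFactorial_neg hζ hodd.pow k) ((n ^ (s + 1) - 1) / 1)
    have hB := (((EvaluatesTo.one (p ^ 2)).neg.pow ((n - 1) / 2)).mul
      (hX.pow ((n - 1) * (1 + n ^ (2 * s + 1)) / 4))).mul
        (evaluatesTo_weightedCentralSum (p ^ 2) hn0 (fun k =>
          isUnit_qShiftedFactorial_neg hζn hodd.pow k) ((n ^ s - 1) / 1))
    rw [pow_one, pow_one] at hA
    refine ⟨_, hA, ?_⟩
    convert hB using 1
    have hval := sum_weightedCentral_dualNumber_value hodd.pow hpn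
    rw [← pow_mul, mul_comm n 2, pow_mul] at hval
    rw [Nat.div_one, Nat.div_one, Nat.sub_add_cancel (hpos _), Nat.sub_add_cancel (hpos _),
      sum_weightedCentral_dualNumber_value hodd.pow hp, hval,
      ← dwork_exponent_eq hn0 (by norm_num) hmod,
      pow_add (p ^ 2) ((n - 1) * (1 + n ^ (2 * s + 1)) / 4), pow_mul (p ^ 2) n, pow_succ' n s,
      neg_one_pow_half_mul hodd hodd.pow]
    ring

theorem mainTheorem7 (n r : ℕ) (hn : 1 < n) (hr : 1 ≤ r) :
    (Odd n → ∀ d : ℕ, d = 1 ∨ d = 2 →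
      RatFuncCongr (dworkModulus n r d)
        (weightedCentralSum RatFunc.X ((n ^ r - 1) / d))
        ((-1) ^ ((n - 1) / 2) * RatFunc.X ^ ((n - 1) * (1 + n ^ (2 * r - 1)) / 4) *
          weightedCentralSum (RatFunc.X ^ n) ((n ^ (r - 1) - 1) / d)) ∧
      RatFuncCongr (dworkModulus n r d)
        (centralSum RatFunc.X ((n ^ r - 1) / d))
        (RatFunc.X ^ ((n - 1) * (1 + n ^ (2 * r - 1)) / 3) *
          ((kroneckerSymbol (-3) n : ℤ) : RatFunc ℤ) *
          centralSum (RatFunc.X ^ n) ((n ^ (r - 1) - 1) / d))) ∧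
    (Even n →
      RatFuncCongr (dworkModulus n r 1)
        (centralSum RatFunc.X (n ^ r - 1))
        (RatFunc.X ^ ((n - 1) * (1 + n ^ (2 * r - 1)) / 3) *
          ((kroneckerSymbol (-3) n : ℤ) : RatFunc ℤ) *
          centralSum (RatFunc.X ^ n) (n ^ (r - 1) - 1))) := by
  obtain ⟨s, rfl⟩ : ∃ s, r = s + 1 := ⟨r - 1, by omega⟩
  rw [kroneckerSymbol_neg_three (by omega), show 2 * (s + 1) - 1 = 2 * s + 1 by omega,
    Nat.add_sub_cancel]
  refine ⟨fun hodd d hd => ⟨weightedCentralSum_congr hn hodd hd,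
    centralSum_congr hn (hd.imp_right fun h => ⟨h, hodd⟩)⟩, fun _ => ?_⟩
  have := centralSum_congr (s := s) hn (Or.inl rfl)
  rwa [Nat.div_one, Nat.div_one] at this
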